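/- **Model.** Fix an identity space and, for each security parameter $\lambda\in\mathbb N$, a value domain $\mathbb U_\lambda\subset[0,1]$ and a finite number $k_\lambda$ of identical items. A *1-message auction* $\Pi_\lambda$ is run by a platform, a seller and a finite set of buyers with distinct identities. Each buyer sends one (possibly randomized) message, computed from its identity, its value and its coins, over a private channel to the platform. From the identities, messages and its own coins the platform either rejects (sends $\bot$ to everyone) or accepts and sends each buyer $i$ a private outcome $(x_i,p_i)$, where $x_i\in\mathbb N$ is the number of items and $p_i\ge 0$ the payment; each buyer then accepts or rejects on the basis of its view. It is required that: if all are honest, all accept with probability 1; if the platform is honest, the honest buyers almost surely agree with its decision; an honest buyer that accepts has $x_i\in\{0,1\}$ and $p_i\le x_iv_i$; the honest platform sells at most $k_\lambda$ items in total. The auction is *weakly symmetric*: its honest outcomes are distributed as if the values were sorted (ties broken by a random rule that may depend on the identities), a random rule depending only on the sorted vector were applied, and each buyer received the outcome of its position. A *strategic buyer* with true value $v$ sends arbitrary messages under a set of identities of its choice, against the honest platform and other honest buyers; its utility is $v$ minus its total payment if the platform accepts and it gets an item, and $0$ otherwise. A *strategic platform–seller coalition* sees the messages of the honest buyers and sends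 each of them $\bot$ or an outcome, never allocating more than $k_\lambda$ items; its utility is the sum of the honest buyers' payments if all honest buyers accept, and $0$ otherwise. Below, statements about values hold for every choice of identities. A function $\varepsilon:\mathbb N\to[0,\infty)$ is *negligible* if for every positive polynomial $q$, $\varepsilon(\lambda)<1/q(\lambda)$ for all large $\lambda$. *Information-theoretic bIC (psIC)*: for every $\lambda$, no strategy of a single buyer (of the platform–seller coalition), whatever the honest buyers' values and the strategic buyer's true value, has a larger expected utility than honest play. *Computational bIC (psIC)*: for every polynomial $n(\cdot)$ and every non-uniform probabilistic polynomial-time strategy there is a negligible $\varepsilon$ such that for every $\lambda$, at most $n(\lambda)$ honest buyers, and all values, the expected utility exceeds that of honest play by at most $\varepsilon(\lambda)$. In the *Bayesian* versions with respect to $\mathcal D_\lambda$ on $\mathbb U_\lambda$, the honest buyers' values are i.i.d. from $\mathcal D_\lambda$ and the expectation is also over them (the true value of a strategic buyer stays arbitrary). In the computational setting the honest players are (possibly non-uniform) probabilistic polynomial time, and identities, values and outcomes are encoded by polynomially many bits, with the order of payments decidable in polynomial time; in particular $\mathbb U_\lambda$ is finite. For a finite value vector $\mathbf b$ let $\mathrm{Rev}_\lambda(\mathbf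 b)$ be the expected total payment of $\Pi_\lambda$ in the honest execution, and let $\mathrm{Post}_{r}(\mathbf b)=r\cdot\min(k_\lambda,\#\{i:b_i\ge r\})$ be the revenue of the posted price auction with reserve $r\ge 0$. **Theorem.** Let $\Pi_\lambda$ be a family of 1-message auctions as above. 1. If $\Pi_\lambda$ satisfies computational bIC and computational psIC, then there are reserves $r_\lambda\ge 0$ such that for every polynomial $n(\cdot)$ there is a negligible function $\varepsilon$ such that for every $\lambda$ and every value vector $\mathbf b$ over $\mathbb U_\lambda$ of length at most $n(\lambda)$, $$\mathrm{Rev}_\lambda(\mathbf b)\le \mathrm{Post}_{r_\lambda}(\mathbf b)+\varepsilon(\lambda).$$ 2. If $\Pi_\lambda$ (not necessarily efficient, with $\mathbb U_\lambda\subset[0,1]$ arbitrary) satisfies information-theoretic bIC and psIC, then there are reserves $r_\lambda\ge0$ with $\mathrm{Rev}_\lambda(\mathbf b)\le \mathrm{Post}_{r_\lambda}(\mathbf b)$ for every $\lambda$ and every value vector $\mathbf b$ of any length. 3. If $\Pi_\lambda$ satisfies computational Bayesian bIC and computational Bayesian psIC with respect to polynomial-time samplable distributions $\mathcal D_\lambda$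 on $\mathbb U_\lambda$, then there are reserves $r_\lambda\ge0$ such that for every polynomial $n(\cdot)$ there is a negligible $\varepsilon$ such that for every $\lambda$ and every $n'\le n(\lambda)$, except with probability at most $\varepsilon(\lambda)$ over $\mathbf v\leftarrow\mathcal D_\lambda^{n'}$, $\mathrm{Rev}_\lambda(\mathbf v)\le \mathrm{Post}_{r_\lambda}(\mathbf v)+\varepsilon(\lambda)$. 4. If $\mathbb U_\lambda$ is finite and $\Pi_\lambda$ satisfies information-theoretic Bayesian bIC and psIC with respect to $\mathcal D_\lambda$, then there are reserves $r_\lambda\ge0$ such that for every $\lambda$ and $n$, with probability 1 over $\mathbf v\leftarrow\mathcal D_\lambda^{n}$, $\mathrm{Rev}_\lambda(\mathbf v)\le \mathrm{Post}_{r_\lambda}(\mathbf v)$. -/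

import Mathlib

open MeasureTheory Filter
open scoped NNReal ENNReal

/-! ### Boolean circuits, polynomial bounds, negligible functions -/

/-- Boolean circuits with input wires `ι` and output wires `o`, as straight-line programs: each step
adds one new wire (`none`), whose value is a constant or a binary Boolean function of two
earlier wires; `ret` names the output wires. -/
inductive Circuit (o : Type) : Type → Type 1 where
  | ret {ι : Type} (out : o → ι) : Circuit o ι
  | const {ι : Type} (c : Bool) (rest : Circuit o (Option ι)) : Circuit o ι
  | gate {ι : Type} (f : Bool → Bool → Bool) (i j : ι) (rest : Circuit o (Option ι)) : Circuit o ι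

namespace Circuit

/-- The function computed by a circuit. -/
def eval {o : Type} : {ι : Type} → Circuit o ι → (ι → Bool) → o → Bool
  | _, ret out, x => fun k => x (out k)
  | _, const c rest, x => rest.eval (fun w => w.elim c x)
  | _, gate f i j rest, x => rest.eval (fun w => w.elim (f (x i) (x j)) x)

/-- The number of gates (constants included). -/
def size {o : Type} : {ι : Type} → Circuit o ι → ℕ
  | _, ret _ => 0
  | _, const _ rest => rest.size + 1
  | _, gate _ _ _ rest => rest.size + 1

end Circuit

/-- Bit strings of length `m`. -/
abbrev Bits (m : ℕ) : Type := Fin m → Bool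

/-- `m` independent uniform bits. -/
noncomputable def uniformBits (m : ℕ) : Measure (Bits m) :=
  (PMF.uniformOfFintype (Bits m)).toMeasure

instance uniformBits_isProbabilityMeasure (m : ℕ) : IsProbabilityMeasure (uniformBits m) := by
  unfold uniformBits; infer_instance

/-- Negligible functions: nonnegative, and eventually below `1 / p` for every polynomial `p` that
is positive on the natural numbers. -/
def Negligible (ε : ℕ → ℝ) : Prop :=
  (∀ n, 0 ≤ ε n) ∧
    ∀ p : Polynomial ℝ, (∀ n : ℕ, 0 < p.eval (n : ℝ)) → ∀ᶠ n : ℕ in atTop, ε n < 1 / p.eval (n : ℝ)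

/-! ### One-message auctions -/

/-- A buyer's private outcome `(x, p)`: the number of items allocated to it and its payment. -/
abbrev Outcome : Type := ℕ × ℝ≥0

/-- A one-message auction protocol with identity space `Id` and value domain `U`. Every buyer sends
one message to the platform, computed from its identity, its value and its private coins. From the
participating identities, their messages and its own coins the platform computes its decision
(`true`: accept, `false`: reject, sending `⊥` to everyone) and everyone's private outcome.
Finally a buyer who receives an outcome decides whether to accept, on the basis of its view.
(A buyer who receives `⊥` rejects.) The seller sends no message; its private outcome is not
recorded. -/
structure Protocol (Id : Type) (U : Set ℝ) where
  Msg : Type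
  [msgSpace : MeasurableSpace Msg]
  BuyerCoin : Type
  [buyerSpace : MeasurableSpace BuyerCoin]
  buyerLaw : Measure BuyerCoin
  [buyerProb : IsProbabilityMeasure buyerLaw]
  PlatformCoin : Finset Id → Type
  [platformSpace : ∀ I, MeasurableSpace (PlatformCoin I)]
  platformLaw : ∀ I, Measure (PlatformCoin I)
  [platformProb : ∀ I, IsProbabilityMeasure (platformLaw I)]
  message : Id → U → BuyerCoin → Msg
  platform : ∀ I : Finset Id, (I → Msg) → PlatformCoin I → Bool × (I → Outcome)
  accept : Id → U → BuyerCoin → Outcome → Prop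
  measurable_message : ∀ a v, Measurable (message a v)
  measurable_platform : ∀ I : Finset Id,
    Measurable fun z : (I → Msg) × PlatformCoin I => platform I z.1 z.2
  measurable_accept : ∀ a v, MeasurableSet {z : BuyerCoin × Outcome | accept a v z.1 z.2}

attribute [instance] Protocol.msgSpace Protocol.buyerSpace Protocol.buyerProb
  Protocol.platformSpace Protocol.platformProb

namespace Protocol

variable {Id : Type} {U : Set ℝ} (A : Protocol Id U)

/-- The joint law of the private coins of the honest buyers `I`. -/
noncomputable def coinsLaw (I : Finset Id) : Measure (I → A.BuyerCoin) :=
  Measure.pi fun _ => A.buyerLaw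

/-- The honest messages of the buyers `I` with values `b`. -/
def messages {I : Finset Id} (b : I → U) (ω : I → A.BuyerCoin) : I → A.Msg :=
  fun i => A.message i (b i) (ω i)

/-- The messages when the buyers `I` are honest with values `b` and the identities in `J` send the
messages `m`. -/
def mixedMessages [DecidableEq Id] {I J : Finset Id} (b : I → U) (ω : I → A.BuyerCoin)
    (m : J → A.Msg) : ↥(I ∪ J) → A.Msg :=
  fun i => if h : i.1 ∈ I then A.messages b ω ⟨i.1, h⟩
    else m ⟨i.1, (Finset.mem_union.1 i.2).resolve_left h⟩

/-- The guarantees required of an auction of `k` identical items. -/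
structure IsAuction [DecidableEq Id] (k : ℕ) : Prop where
  /-- If everyone is honest, everyone accepts with probability one. -/
  completeness : ∀ (I : Finset Id) (b : I → U),
    ∀ᵐ ω ∂(A.coinsLaw I).prod (A.platformLaw I),
      (A.platform I (A.messages b ω.1) ω.2).1 = true ∧
        ∀ i : I, A.accept i (b i) (ω.1 i) ((A.platform I (A.messages b ω.1) ω.2).2 i)
  /-- If the platform is honest and accepts, every honest buyer accepts, with probability one,
  whatever the other participants send. -/
  agreement : ∀ (I J : Finset Id), Disjoint I J → ∀ (b : I → U) (m : J → A.Msg),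
    ∀ᵐ ω ∂(A.coinsLaw I).prod (A.platformLaw (I ∪ J)),
      (A.platform (I ∪ J) (A.mixedMessages b ω.1 m) ω.2).1 = true →
        ∀ i : I, A.accept i (b i) (ω.1 i)
          ((A.platform (I ∪ J) (A.mixedMessages b ω.1 m) ω.2).2
            ⟨i.1, Finset.mem_union_left J i.2⟩)
  /-- An honest buyer that accepts has nonnegative utility and gets at most one item. -/
  individually_rational : ∀ (a : Id) (v : U) (ω : A.BuyerCoin) (o : Outcome),
    A.accept a v ω o → o.1 ≤ 1 ∧ (o.2 : ℝ) ≤ o.1 * (v : ℝ)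
  /-- The honest platform sells at most `k` items. -/
  capacity : ∀ (I : Finset Id) (m : I → A.Msg) (c : A.PlatformCoin I),
    (A.platform I m c).1 = true → ∑ i, ((A.platform I m c).2 i).1 ≤ k

/-- The law of the private outcomes in the honest execution with the buyers `I` and values `b`. -/
noncomputable def outcomeLaw (I : Finset Id) (b : I → U) : Measure (I → Outcome) :=
  ((A.coinsLaw I).prod (A.platformLaw I)).map fun ω => (A.platform I (A.messages b ω.1) ω.2).2

open scoped Classical in
/-- Weak symmetry: the honest auction realizes the following functionality. Sort the values, with
ties broken by a random rule `τ` that may depend on the identities; then apply a random rule `G`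
that sees only the sorted vector; finally return to each buyer the outcome of its position. -/
def WeaklySymmetric : Prop :=
  ∃ (τ : ∀ I : Finset Id, (I → U) → PMF (Fin I.card ≃ I))
    (G : ∀ n : ℕ, (Fin n → U) → Measure (Fin n → Outcome)),
    ∀ (I : Finset Id) (b : I → U),
      (∀ σ ∈ (τ I b).support, Antitone fun j => (b (σ j) : ℝ)) ∧
      A.outcomeLaw I b =
        ∑ σ : Fin I.card ≃ I,
          (τ I b σ) • (G I.card fun j => b (σ j)).map fun o i => o (σ.symm i)

/-- The expected total payment in the honest execution with the buyers `I` and values `b`. -/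
noncomputable def revenue (I : Finset Id) (b : I → U) : ℝ :=
  ∫ ω, (if (A.platform I (A.messages b ω.1) ω.2).1 = true
      then ∑ i, (((A.platform I (A.messages b ω.1) ω.2).2 i).2 : ℝ) else 0)
    ∂(A.coinsLaw I).prod (A.platformLaw I)

/-! ### Strategic buyers -/

/-- A strategy of a buyer: it participates under the identities `ids` (one or more, or none at
all), and sends on their behalf arbitrary, possibly random, messages. Nothing is received before
sending. -/
structure BuyerStrategy where
  ids : Finset Id
  Coin : Type
  [coinSpace : MeasurableSpace Coin]
  law : Measure Coin
  [prob : IsProbabilityMeasure law]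
  send : Coin → ids → A.Msg
  measurable_send : Measurable send

attribute [instance] BuyerStrategy.coinSpace BuyerStrategy.prob

/-- Honest play of the buyer with identity `a` and value `v`. -/
def honestBuyer (a : Id) (v : U) : A.BuyerStrategy where
  ids := {a}
  Coin := A.BuyerCoin
  law := A.buyerLaw
  send := fun ω _ => A.message a v ω
  measurable_send := measurable_pi_lambda _ fun _ => A.measurable_message a v

/-- The utility of a buyer with true value `v` and identities `J`, given the honest platform's
output: zero if the platform rejects or if the buyer gets no item, otherwise `v` minus its total
payment. -/
noncomputable def buyerPayoff (v : ℝ) {K : Finset Id} (J : Finset Id) (hJ : J ⊆ K)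
    (out : Bool × (K → Outcome)) : ℝ :=
  if out.1 = true ∧ 0 < ∑ j : J, (out.2 ⟨j.1, hJ j.2⟩).1
    then v - ∑ j : J, ((out.2 ⟨j.1, hJ j.2⟩).2 : ℝ) else 0

/-- The expected utility of a buyer with true value `v` that plays `S`, when the platform is honest
and the other buyers `I` are honest with values `b`. -/
noncomputable def buyerUtility [DecidableEq Id] (S : A.BuyerStrategy) (I : Finset Id) (b : I → U)
    (v : U) : ℝ :=
  ∫ ω, buyerPayoff (v : ℝ) S.ids Finset.subset_union_right
      (A.platform (I ∪ S.ids) (A.mixedMessages b ω.1.1 (S.send ω.2)) ω.1.2)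
    ∂((A.coinsLaw I).prod (A.platformLaw (I ∪ S.ids))).prod S.law

/-! ### The strategic platform-seller coalition -/

/-- A strategy of the platform-seller coalition: given the messages of the honest buyers `I` it
sends to each of them either `⊥` (first component `false`) or a private outcome. (Fake buyers are
internal to the coalition.) -/
structure PlatformStrategy where
  Coin : Finset Id → Type
  [coinSpace : ∀ I, MeasurableSpace (Coin I)]
  law : ∀ I, Measure (Coin I)
  [prob : ∀ I, IsProbabilityMeasure (law I)]
  act : ∀ I : Finset Id, (I → A.Msg) → Coin I → I → Bool × Outcome
  measurable_act : ∀ I : Finset Id, Measurable fun z : (I → A.Msg) × Coin I => act I z.1 z.2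

attribute [instance] PlatformStrategy.coinSpace PlatformStrategy.prob

/-- The coalition never hands out more than the `k` items. -/
def PlatformStrategy.Feasible {A : Protocol Id U} (S : A.PlatformStrategy) (k : ℕ) : Prop :=
  ∀ (I : Finset Id) (m : I → A.Msg) (c : S.Coin I),
    (∑ i, if (S.act I m c i).1 = true then (S.act I m c i).2.1 else 0) ≤ k

/-- Honest play of the platform-seller coalition. -/
def honestPlatform : A.PlatformStrategy where
  Coin := A.PlatformCoin
  law := A.platformLaw
  act := fun I m c i => ((A.platform I m c).1, (A.platform I m c).2 i)
  measurable_act := fun I => measurable_pi_lambda _ fun i =>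
    (A.measurable_platform I).fst.prodMk ((measurable_pi_apply i).comp (A.measurable_platform I).snd)

open scoped Classical in
/-- The expected utility of the coalition playing `S` against the honest buyers `I` with values `b`:
on a safe trace (all honest buyers accept) the sum of their payments, otherwise zero. -/
noncomputable def coalitionUtility (S : A.PlatformStrategy) (I : Finset Id) (b : I → U) : ℝ :=
  ∫ ω, (if ∀ i : I, (S.act I (A.messages b ω.1) ω.2 i).1 = true ∧
        A.accept i (b i) (ω.1 i) (S.act I (A.messages b ω.1) ω.2 i).2
      then ∑ i, ((S.act I (A.messages b ω.1) ω.2 i).2.2 : ℝ) else 0)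
    ∂(A.coinsLaw I).prod (S.law I)

/-! ### Information-theoretic incentive compatibility -/

/-- Information-theoretic (ex post) buyer incentive compatibility. -/
def BuyerIC [DecidableEq Id] : Prop :=
  ∀ (S : A.BuyerStrategy) (I : Finset Id) (b : I → U) (a : Id) (v : U),
    a ∉ I → Disjoint I S.ids →
      A.buyerUtility S I b v ≤ A.buyerUtility (A.honestBuyer a v) I b v

/-- Information-theoretic (ex post) platform-seller incentive compatibility. -/
def PlatformSellerIC (k : ℕ) : Prop :=
  ∀ S : A.PlatformStrategy, S.Feasible k → ∀ (I : Finset Id) (b : I → U),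
    A.coalitionUtility S I b ≤ A.coalitionUtility A.honestPlatform I b

/-- Information-theoretic Bayesian buyer incentive compatibility; the values of the other buyers
are independent samples of `D`. -/
def BayesBuyerIC [DecidableEq Id] (D : PMF U) : Prop :=
  ∀ (S : A.BuyerStrategy) (I : Finset Id) (a : Id) (v : U),
    a ∉ I → Disjoint I S.ids →
      ∫ b, A.buyerUtility S I b v ∂(Measure.pi fun _ : I => D.toMeasure) ≤
        ∫ b, A.buyerUtility (A.honestBuyer a v) I b v ∂(Measure.pi fun _ : I => D.toMeasure)

/-- Information-theoretic Bayesian platform-seller incentive compatibility. -/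
def BayesPlatformSellerIC (k : ℕ) (D : PMF U) : Prop :=
  ∀ S : A.PlatformStrategy, S.Feasible k → ∀ I : Finset Id,
    ∫ b, A.coalitionUtility S I b ∂(Measure.pi fun _ : I => D.toMeasure) ≤
      ∫ b, A.coalitionUtility A.honestPlatform I b ∂(Measure.pi fun _ : I => D.toMeasure)

end Protocol

open scoped Classical in
/-- The revenue of the posted price auction of `k` items with reserve `r`: every buyer whose value
is at least `r` wants to buy at price `r`, and at most `k` of them can. -/
noncomputable def postedRevenue {ι : Type} [Fintype ι] {U : Set ℝ} (k : ℕ) (r : ℝ≥0)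
    (b : ι → U) : ℝ :=
  (r : ℝ) * (min k (Finset.univ.filter fun i => (r : ℝ) ≤ (b i : ℝ)).card : ℕ)

/-! ### Polynomial-time auctions -/

/-- A family of one-message auction protocols, indexed by the security parameter `κ`, with
polynomial-time honest players. Identities, values, messages, coins and outcomes are bit strings
of polynomial length; the honest algorithms are given by polynomial-size circuits (so that
non-uniform polynomial-time auctions are covered too); payments are represented in such a way that
their order is decidable in polynomial time. No efficiency is required of the buyers' final
acceptance decision. -/
structure EfficientProtocol (U : ℕ → Set ℝ) where
  idLen : ℕ → ℕ
  valLen : ℕ → ℕ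
  msgLen : ℕ → ℕ
  outLen : ℕ → ℕ
  buyerCoinLen : ℕ → ℕ
  /-- The length of the platform's random tape when there are `n` participants. -/
  platformCoinLen : ℕ → ℕ → ℕ
  /-- The binary representation of values. -/
  encode : ∀ κ, U κ → Bits (valLen κ)
  encode_injective : ∀ κ, Function.Injective (encode κ)
  /-- The outcome represented by a bit string. -/
  decode : ∀ κ, Bits (outLen κ) → Outcome
  /-- Identity, value and coins to message. -/
  buyer : ∀ κ, Circuit (Fin (msgLen κ))
    ((Fin (idLen κ) ⊕ Fin (valLen κ)) ⊕ Fin (buyerCoinLen κ))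
  /-- The `n` participants' identities and messages (in the order of the identities), and coins, to
  the decision (`none`) and the `n` outcomes. -/
  platform : ∀ κ n, Circuit (Option (Fin n × Fin (outLen κ)))
    ((Fin n × (Fin (idLen κ) ⊕ Fin (msgLen κ))) ⊕ Fin (platformCoinLen κ n))
  accept : ∀ κ, Fin (2 ^ idLen κ) → U κ → Bits (buyerCoinLen κ) → Outcome → Prop
  polynomial : ∃ q : Polynomial ℕ, ∀ κ,
    idLen κ ≤ q.eval κ ∧ valLen κ ≤ q.eval κ ∧ msgLen κ ≤ q.eval κ ∧ outLen κ ≤ q.eval κ ∧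
    buyerCoinLen κ ≤ q.eval κ ∧ (buyer κ).size ≤ q.eval κ ∧
    (∀ n, platformCoinLen κ n ≤ q.eval (κ + n) ∧ (platform κ n).size ≤ q.eval (κ + n)) ∧
    ∃ C : Circuit Unit (Fin (outLen κ) ⊕ Fin (outLen κ)), C.size ≤ q.eval κ ∧
      ∀ x y : Bits (outLen κ),
        C.eval (Sum.elim x y) () = true ↔ (decode κ x).2 ≤ (decode κ y).2

namespace EfficientProtocol

variable {U : ℕ → Set ℝ} (P : EfficientProtocol U)

/-- Identities are bit strings of length `idLen κ`, written as numbers. -/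
abbrev Id (κ : ℕ) : Type := Fin (2 ^ P.idLen κ)

/-- The input bits, read off the identities (listed in increasing order), messages and coins. -/
def inputBits {κ c : ℕ} (I : Finset (P.Id κ)) (m : I → Bits (P.msgLen κ)) (r : Bits c) :
    (Fin I.card × (Fin (P.idLen κ) ⊕ Fin (P.msgLen κ))) ⊕ Fin c → Bool :=
  Sum.elim
    (fun z => Sum.elim (fun t : Fin (P.idLen κ) => (I.orderIsoOfFin rfl z.1).1.1.testBit t)
      (fun t => m (I.orderIsoOfFin rfl z.1) t) z.2) r

/-- The auction protocol run with security parameter `κ`. -/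
noncomputable def protocol (κ : ℕ) : Protocol (P.Id κ) (U κ) where
  Msg := Bits (P.msgLen κ)
  BuyerCoin := Bits (P.buyerCoinLen κ)
  buyerLaw := uniformBits _
  PlatformCoin := fun I => Bits (P.platformCoinLen κ I.card)
  platformLaw := fun _ => uniformBits _
  message := fun a v ω => (P.buyer κ).eval
    (Sum.elim (Sum.elim (fun t : Fin (P.idLen κ) => a.1.testBit t) (P.encode κ v)) ω)
  platform := fun I m c =>
    let out := (P.platform κ I.card).eval (P.inputBits I m c)
    (out none, fun i => P.decode κ fun t => out (some ((I.orderIsoOfFin rfl).symm i, t)))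
  accept := fun a v ω o => o ∈ Set.range (P.decode κ) ∧ P.accept κ a v ω o
  measurable_message := fun _ _ => measurable_of_countable _
  measurable_platform := fun _ => measurable_of_countable _
  measurable_accept := fun _ _ =>
    ((Set.finite_univ.prod (Set.finite_range (P.decode κ))).subset
      fun _ h => ⟨trivial, h.1⟩).measurableSet

/-- A family of auctions for the item numbers `k`. -/
def IsAuction (k : ℕ → ℕ) : Prop :=
  ∀ κ, (P.protocol κ).IsAuction (k κ) ∧ (P.protocol κ).WeaklySymmetric

/-- A non-uniform probabilistic polynomial-time strategy of a buyer. The advice of `κ` includes the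
identities that it takes on; they are polynomially many. -/
structure BuyerAttack where
  ids : ∀ κ, Finset (P.Id κ)
  coinLen : ℕ → ℕ
  send : ∀ κ, Circuit (ids κ × Fin (P.msgLen κ)) (Fin (coinLen κ))
  polynomial : ∃ q : Polynomial ℕ, ∀ κ,
    (ids κ).card ≤ q.eval κ ∧ coinLen κ ≤ q.eval κ ∧ (send κ).size ≤ q.eval κ

/-- The strategy for security parameter `κ`. -/
noncomputable def BuyerAttack.strategy {P : EfficientProtocol U} (S : P.BuyerAttack) (κ : ℕ) :
    (P.protocol κ).BuyerStrategy where
  ids := S.ids κ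
  Coin := Bits (S.coinLen κ)
  coinSpace := inferInstance
  law := uniformBits _
  prob := inferInstance
  send := fun c i => fun t => (S.send κ).eval c (i, t)
  measurable_send := measurable_pi_lambda _ fun _ =>
    (measurable_of_countable (_ : Bits (S.coinLen κ) → Bits (P.msgLen κ)))

/-- A non-uniform probabilistic polynomial-time strategy of the platform-seller coalition. For `n`
honest buyers it maps their identities and messages (in the order of the identities) and coins to
what each of them is sent: a bit (`none`) that is false for `⊥`, and an outcome. -/
structure PlatformAttack where
  coinLen : ℕ → ℕ → ℕ
  act : ∀ κ n, Circuit (Fin n × Option (Fin (P.outLen κ)))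
    ((Fin n × (Fin (P.idLen κ) ⊕ Fin (P.msgLen κ))) ⊕ Fin (coinLen κ n))
  polynomial : ∃ q : Polynomial ℕ, ∀ κ n,
    coinLen κ n ≤ q.eval (κ + n) ∧ (act κ n).size ≤ q.eval (κ + n)

/-- The strategy for security parameter `κ`. -/
noncomputable def PlatformAttack.strategy {P : EfficientProtocol U} (S : P.PlatformAttack)
    (κ : ℕ) : (P.protocol κ).PlatformStrategy where
  Coin := fun I => Bits (S.coinLen κ I.card)
  coinSpace := fun _ => inferInstance
  law := fun _ => uniformBits _
  prob := fun _ => inferInstance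
  act := fun I m c i =>
    let out := fun w => (S.act κ I.card).eval (P.inputBits I m c) ((I.orderIsoOfFin rfl).symm i, w)
    (out none, P.decode κ fun t => out (some t))
  measurable_act := fun I => by
    have : Countable ((I → Bits (P.msgLen κ)) × Bits (S.coinLen κ I.card)) := inferInstance
    exact measurable_of_countable (α := (I → Bits (P.msgLen κ)) × Bits (S.coinLen κ I.card)) _

/-! ### Computational incentive compatibility -/

/-- Computational (ex post) buyer incentive compatibility. -/
def CompBuyerIC : Prop :=
  ∀ (N : Polynomial ℕ) (S : P.BuyerAttack), ∃ ε : ℕ → ℝ, Negligible ε ∧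
    ∀ (κ : ℕ) (I : Finset (P.Id κ)), I.card ≤ N.eval κ →
      ∀ (b : I → U κ) (a : P.Id κ) (v : U κ), a ∉ I → Disjoint I (S.ids κ) →
        (P.protocol κ).buyerUtility (S.strategy κ) I b v ≤
          (P.protocol κ).buyerUtility ((P.protocol κ).honestBuyer a v) I b v + ε κ

/-- Computational (ex post) platform-seller incentive compatibility. -/
def CompPlatformSellerIC (k : ℕ → ℕ) : Prop :=
  ∀ (N : Polynomial ℕ) (S : P.PlatformAttack), (∀ κ, (S.strategy κ).Feasible (k κ)) →
    ∃ ε : ℕ → ℝ, Negligible ε ∧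
      ∀ (κ : ℕ) (I : Finset (P.Id κ)), I.card ≤ N.eval κ → ∀ b : I → U κ,
        (P.protocol κ).coalitionUtility (S.strategy κ) I b ≤
          (P.protocol κ).coalitionUtility (P.protocol κ).honestPlatform I b + ε κ

/-- The distributions `D κ` on the value domains are polynomial-time samplable. -/
def Samplable (D : ∀ κ, PMF (U κ)) : Prop :=
  ∃ (c : ℕ → ℕ) (C : ∀ κ, Circuit (Fin (P.valLen κ)) (Fin (c κ))) (q : Polynomial ℕ), ∀ κ,
    c κ ≤ q.eval κ ∧ (C κ).size ≤ q.eval κ ∧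
    (PMF.uniformOfFintype (Bits (c κ))).map (C κ).eval = (D κ).map (P.encode κ)

/-- Computational Bayesian buyer incentive compatibility. -/
def CompBayesBuyerIC (D : ∀ κ, PMF (U κ)) : Prop :=
  ∀ (N : Polynomial ℕ) (S : P.BuyerAttack), ∃ ε : ℕ → ℝ, Negligible ε ∧
    ∀ (κ : ℕ) (I : Finset (P.Id κ)), I.card ≤ N.eval κ →
      ∀ (a : P.Id κ) (v : U κ), a ∉ I → Disjoint I (S.ids κ) →
        ∫ b, (P.protocol κ).buyerUtility (S.strategy κ) I b v
            ∂(Measure.pi fun _ : I => (D κ).toMeasure) ≤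
          (∫ b, (P.protocol κ).buyerUtility ((P.protocol κ).honestBuyer a v) I b v
            ∂(Measure.pi fun _ : I => (D κ).toMeasure)) + ε κ

/-- Computational Bayesian platform-seller incentive compatibility. -/
def CompBayesPlatformSellerIC (k : ℕ → ℕ) (D : ∀ κ, PMF (U κ)) : Prop :=
  ∀ (N : Polynomial ℕ) (S : P.PlatformAttack), (∀ κ, (S.strategy κ).Feasible (k κ)) →
    ∃ ε : ℕ → ℝ, Negligible ε ∧
      ∀ (κ : ℕ) (I : Finset (P.Id κ)), I.card ≤ N.eval κ →
        ∫ b, (P.protocol κ).coalitionUtility (S.strategy κ) I b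
            ∂(Measure.pi fun _ : I => (D κ).toMeasure) ≤
          (∫ b, (P.protocol κ).coalitionUtility (P.protocol κ).honestPlatform I b
            ∂(Measure.pi fun _ : I => (D κ).toMeasure)) + ε κ

end EfficientProtocol

/-! ### Product measures -/

/-! Revenue is a sum of individual payments, and each payment is compared with one posted price in
two steps.

Competition adds almost nothing. A coalition that faces only buyer `i` can run the honest platform
in its head with invented messages of competitors and invented coins, and send `i` whichever of the
simulated and the honest solo outcome charges more. For honestly distributed inventions `i` accepts
almost surely, so platform-seller compatibility bounds `gap`, the expected positive part of (payment
among competitors) minus (payment alone), where both executions share the coins of `i` and have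
independent platform coins (`soloUtility_better_sub`, `sum_mul_gap_le`). For `I = {a}` the same
bound says that, given the message, the payment of a lone buyer hardly depends on the platform's
coins (`gap_singleton`).

A lone buyer faces a price. Let `1 - r` be the supremum over messages of the expected utility of a
lone buyer of value one. Lowering the value to `v` loses at most `1 - v`, so buyer compatibility
guarantees an honest buyer about `v - r`. No message beats the honest average either, so the mean
payment given the message exceeds `r` only by an amount that is small on average, and near-constancy
in the coins carries this to the payment itself (`integral_excess_le`). If `v < r`, consider a
message that wins with probability `α` at mean price `β ≤ v`. Value one cannot gain more than `1 -
r` from it, so `1 - α ≥ r - β ≥ r - v`: it loses with sizeable probability, and a loser pays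
nothing. A substantial payment would then vary with the coins (`mul_integral_payment_le`).

Weak symmetry makes the solo outcome law independent of the identity, so one `r` serves everybody,
and capacity bounds the number of payments of `r` (`sum_paid_le`, `revenue_le`).

In the computational setting the invented data are non-uniform advice, and choosing nearly worst
advice gives a single negligible error (`Negligible.exists_uniform`). Since the second case divides
by `r - v`, the reserve is lowered by a negligible `η` that balances `η` against the gap divided by
`η`. In the Bayesian setting the bounds hold on average; nonnegativity of the errors then gives
almost sure vanishing or, by Markov's inequality, a high-probability bound. -/

theorem measurePreserving_update {ι α : Type*} [Fintype ι] [DecidableEq ι] [MeasurableSpace α]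
    (μ : Measure α) [IsProbabilityMeasure μ] (i : ι) :
    MeasurePreserving (fun z : (ι → α) × α => Function.update z.1 i z.2)
      ((Measure.pi fun _ => μ).prod μ) (Measure.pi fun _ => μ) := by
  have hm : Measurable fun z : (ι → α) × α => Function.update z.1 i z.2 := by
    refine measurable_pi_lambda _ fun j => ?_
    by_cases h : j = i
    · subst h; simpa using measurable_snd
    · simp only [Function.update_of_ne h]
      exact (measurable_pi_apply j).comp measurable_fst
  refine ⟨hm, (Measure.pi_eq fun s hs => ?_).symm⟩
  rw [Measure.map_apply hm (MeasurableSet.univ_pi hs)]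
  have : (fun z : (ι → α) × α => Function.update z.1 i z.2) ⁻¹' Set.univ.pi s
      = (Set.univ.pi (Function.update s i Set.univ)) ×ˢ s i := by
    ext z
    simp only [Set.mem_preimage, Set.mem_pi, Set.mem_univ, true_implies, Set.mem_prod]
    constructor
    · intro h
      refine ⟨fun j => ?_, by simpa using h i⟩
      by_cases hj : j = i
      · subst hj; simp
      · simpa [hj] using h j
    · rintro ⟨h, h'⟩ j
      by_cases hj : j = i
      · subst hj; simpa using h'
      · simpa [hj] using h j
  rw [this, Measure.prod_prod, Measure.pi_pi, ← Finset.mul_prod_erase Finset.univ _ (Finset.mem_univ i),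
    ← Finset.mul_prod_erase Finset.univ (fun j => μ (s j)) (Finset.mem_univ i)]
  simp only [Function.update_self, measure_univ, one_mul]
  rw [mul_comm]
  congr 1
  exact Finset.prod_congr rfl fun j hj => by rw [Function.update_of_ne (Finset.ne_of_mem_erase hj)]

theorem measurePreserving_const_of_unique {ι α : Type*} [Unique ι] [Fintype ι] [MeasurableSpace α]
    (μ : Measure α) [IsProbabilityMeasure μ] :
    MeasurePreserving (fun (x : α) (_ : ι) => x) μ (Measure.pi fun _ => μ) := by
  have hm : Measurable fun (x : α) (_ : ι) => x := measurable_pi_lambda _ fun _ => measurable_id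
  refine ⟨hm, (Measure.pi_eq fun s hs => ?_).symm⟩
  rw [Measure.map_apply hm (MeasurableSet.univ_pi hs)]
  have : (fun (x : α) (_ : ι) => x) ⁻¹' Set.univ.pi s = s default := by
    ext x
    simp [Unique.forall_iff]
  rw [this, Fintype.prod_unique]

theorem integrable_of_bounds {α : Type*} [MeasurableSpace α] {μ : Measure α} [IsFiniteMeasure μ]
    {f : α → ℝ} (hf : Measurable f) (a b : ℝ) (h : ∀ x, f x ∈ Set.Icc a b) : Integrable f μ :=
  Integrable.of_mem_Icc a b hf.aemeasurable (ae_of_all _ h)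

theorem MeasureTheory.MeasurePreserving.integral_comp_measurable {α β : Type*} [MeasurableSpace α]
    [MeasurableSpace β] {μ : Measure α} {ν : Measure β} {f : α → β}
    (hf : MeasurePreserving f μ ν) {g : β → ℝ} (hg : Measurable g) :
    ∫ y, g y ∂ν = ∫ x, g (f x) ∂μ := by
  rw [← hf.map_eq, integral_map hf.measurable.aemeasurable hg.aestronglyMeasurable]

/-! ### A seller facing a single buyer -/

theorem resample_mem_Icc {γ : Type*} {P : γ → ℝ} (hP0 : ∀ z, 0 ≤ P z) (hP1 : ∀ z, P z ≤ 1) (y z : γ) :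
    max (P y - P z) 0 ∈ Set.Icc (0 : ℝ) 1 :=
  ⟨le_max_right _ _, max_le (by linarith [hP0 z, hP1 y]) zero_le_one⟩

section Solo

variable {Ω C : Type*} [MeasurableSpace Ω] [MeasurableSpace C] {μ : Measure Ω} {ν : Measure C}
  [IsProbabilityMeasure μ] [IsProbabilityMeasure ν]

/-- The expected gain from choosing the better of two outcomes for the same message. -/
noncomputable def resampleGain (μ : Measure Ω) (ν : Measure C) (P : Ω × C → ℝ) : ℝ :=
  ∫ ω, ∫ c', ∫ c, max (P (ω, c') - P (ω, c)) 0 ∂ν ∂ν ∂μ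

variable {X P : Ω × C → ℝ} {v : ℝ}

theorem measurable_integral_resample (hP : Measurable P) :
    Measurable fun y : Ω × C => ∫ c, max (P y - P (y.1, c)) 0 ∂ν := by
  have : Measurable fun y : (Ω × C) × C => max (P y.1 - P (y.1.1, y.2)) 0 := by fun_prop
  exact this.stronglyMeasurable.integral_prod_right.measurable

/-- Measurability is not needed: a nonintegrable function has integral `0`, which lies in the
interval. -/
theorem integral_mem_Icc {α : Type*} [MeasurableSpace α] {ρ : Measure α} [IsProbabilityMeasure ρ]
    {f : α → ℝ} (h : ∀ x, f x ∈ Set.Icc (0 : ℝ) 1) : ∫ x, f x ∂ρ ∈ Set.Icc (0 : ℝ) 1 := by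
  refine ⟨integral_nonneg fun x => (h x).1, ?_⟩
  by_cases hf : Integrable f ρ
  · simpa using integral_mono hf (integrable_const (1 : ℝ)) fun x => (h x).2
  · simp [integral_undef hf]

/-- Let `g(ω)` be `u + ε` minus the utility given `ω`, where `u` is the mean utility. By `h3` it is
nonnegative almost surely, and its mean is exactly `ε`. It also dominates the mean payment given `ω`
minus `r`, and the fluctuation of the payment around that mean is paid for by `resampleGain`. -/
theorem integral_excess_le (hX : Measurable X) (hP : Measurable P)
    (hX01 : ∀ z, X z = 0 ∨ X z = 1) (hP0 : ∀ z, 0 ≤ P z) (hPX : ∀ z, P z ≤ v * X z)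
    (hv0 : 0 ≤ v) (hv1 : v ≤ 1) {r ε : ℝ}
    (h2 : 1 - r ≤ ∫ z, (v * X z - P z) ∂(μ.prod ν) + ε + (1 - v))
    (h3 : ∀ᵐ ω ∂μ, ∫ c, (v * X (ω, c) - P (ω, c)) ∂ν
      ≤ ∫ z, (v * X z - P z) ∂(μ.prod ν) + ε) :
    ∫ z, max (P z - r) 0 ∂(μ.prod ν) ≤ ε + resampleGain μ ν P := by
  have hX1 : ∀ z, X z ∈ Set.Icc (0 : ℝ) 1 := fun z => by
    rcases hX01 z with h | h <;> simp [h]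
  have hP1 : ∀ z, P z ≤ 1 := fun z => (hPX z).trans <| by
    nlinarith [(hX1 z).1, (hX1 z).2]
  set u := ∫ z, (v * X z - P z) ∂(μ.prod ν) with hu
  have hW : Integrable (fun z => v * X z - P z) (μ.prod ν) :=
    integrable_of_bounds (by fun_prop) (-1) 1 fun z =>
      ⟨by nlinarith [(hX1 z).1, hP1 z], by nlinarith [(hX1 z).1, (hX1 z).2, hP0 z]⟩
  have hgi : Integrable (fun ω => u + ε - ∫ c, (v * X (ω, c) - P (ω, c)) ∂ν) μ :=
    (integrable_const _).sub hW.integral_prod_left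
  have hfi : Integrable (fun z => max (P z - r) 0) (μ.prod ν) :=
    integrable_of_bounds (by fun_prop) 0 (max (1 - r) 0) fun z =>
      ⟨le_max_right _ _, max_le_max_right _ (by linarith [hP1 z])⟩
  have hin := resample_mem_Icc hP0 hP1
  have hmid : Integrable (fun y : Ω × C => ∫ c, max (P y - P (y.1, c)) 0 ∂ν) (μ.prod ν) :=
    integrable_of_bounds (measurable_integral_resample hP) 0 1 fun y =>
      integral_mem_Icc fun c => hin _ _
  have key : ∀ᵐ ω ∂μ, ∫ c', max (P (ω, c') - r) 0 ∂ν ≤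
      (u + ε - ∫ c, (v * X (ω, c) - P (ω, c)) ∂ν) +
        ∫ c', ∫ c, max (P (ω, c') - P (ω, c)) 0 ∂ν ∂ν := by
    filter_upwards [h3] with ω hω
    set g := u + ε - ∫ c, (v * X (ω, c) - P (ω, c)) ∂ν with hg
    have hPi : Integrable (fun c => P (ω, c)) ν :=
      integrable_of_bounds (hP.comp measurable_prodMk_left) 0 1 fun c => ⟨hP0 _, hP1 _⟩
    have hXi : Integrable (fun c => X (ω, c)) ν :=
      integrable_of_bounds (hX.comp measurable_prodMk_left) 0 1 fun c => hX1 _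
    have hXle : ∫ c, X (ω, c) ∂ν ≤ 1 := (integral_mem_Icc fun c => hX1 _).2
    have hsplit : ∫ c, (v * X (ω, c) - P (ω, c)) ∂ν
        = v * ∫ c, X (ω, c) ∂ν - ∫ c, P (ω, c) ∂ν := by
      rw [integral_sub (hXi.const_mul v) hPi, integral_const_mul]
    -- `h2` says `u + ε ≥ v - r`, and the value part of the utility given `ω` is at most `v`.
    have hβ : ∫ c, P (ω, c) ∂ν - r ≤ g := by
      nlinarith
    have hpt : ∀ c', max (P (ω, c') - r) 0 ≤ g + ∫ c, max (P (ω, c') - P (ω, c)) 0 ∂ν := by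
      intro c'
      have h0 : (0 : ℝ) ≤ ∫ c, max (P (ω, c') - P (ω, c)) 0 ∂ν :=
        integral_nonneg fun c => le_max_right _ _
      have h1 : P (ω, c') - ∫ c, P (ω, c) ∂ν ≤ ∫ c, max (P (ω, c') - P (ω, c)) 0 ∂ν := by
        have : ∫ c, (P (ω, c') - P (ω, c)) ∂ν = P (ω, c') - ∫ c, P (ω, c) ∂ν := by
          rw [integral_sub (integrable_const _) hPi]; simp
        rw [← this]
        refine integral_mono ((integrable_const _).sub hPi) ?_ fun c => le_max_left _ _
        exact integrable_of_bounds (by fun_prop) 0 1 fun c => hin _ _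
      exact max_le (by linarith) (by linarith)
    have hIi : Integrable (fun c' => ∫ c, max (P (ω, c') - P (ω, c)) 0 ∂ν) ν :=
      integrable_of_bounds ((measurable_integral_resample hP).comp measurable_prodMk_left) 0 1
        fun c' => integral_mem_Icc fun c => hin _ _
    calc _ ≤ ∫ c', (g + ∫ c, max (P (ω, c') - P (ω, c)) 0 ∂ν) ∂ν := by
          refine integral_mono ?_ ((integrable_const _).add hIi) hpt
          exact integrable_of_bounds (by fun_prop) 0 (max (1 - r) 0) fun c =>
            ⟨le_max_right _ _, max_le_max_right _ (by linarith [hP1 (ω, c)])⟩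
      _ = _ := by rw [integral_add (integrable_const _) hIi]; simp
  rw [integral_prod _ hfi]
  calc _ ≤ ∫ ω, ((u + ε - ∫ c, (v * X (ω, c) - P (ω, c)) ∂ν) +
        ∫ c', ∫ c, max (P (ω, c') - P (ω, c)) 0 ∂ν ∂ν) ∂μ :=
        integral_mono_ae hfi.integral_prod_left (hgi.add hmid.integral_prod_left) key
    _ = _ := by
        rw [integral_add hgi hmid.integral_prod_left,
          integral_sub (integrable_const _) hW.integral_prod_left, ← integral_prod _ hW, ← hu]
        simp [resampleGain]

/-- Given `ω`, let `α` be the winning probability and `β` the mean payment. A draw that loses pays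
nothing, so pairing it with an independent draw exposes the latter's whole payment to resampling: `β
* (1 - α)` is at most the gain. The hypothesis `h1` and `β ≤ v` give `1 - α ≥ r - v`. -/
theorem mul_integral_payment_le (hX : Measurable X) (hP : Measurable P)
    (hX01 : ∀ z, X z = 0 ∨ X z = 1) (hP0 : ∀ z, 0 ≤ P z) (hPX : ∀ z, P z ≤ v * X z)
    (hv0 : 0 ≤ v) (hv1 : v ≤ 1) {r : ℝ}
    (h1 : ∀ᵐ ω ∂μ, ∫ c, (X (ω, c) - P (ω, c)) ∂ν ≤ 1 - r) :
    (r - v) * ∫ z, P z ∂(μ.prod ν) ≤ resampleGain μ ν P := by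
  have hX1 : ∀ z, X z ∈ Set.Icc (0 : ℝ) 1 := fun z => by
    rcases hX01 z with h | h <;> simp [h]
  have hP1 : ∀ z, P z ≤ 1 := fun z => (hPX z).trans <| by
    nlinarith [(hX1 z).1, (hX1 z).2]
  have hin := resample_mem_Icc hP0 hP1
  have hmid : Integrable (fun y : Ω × C => ∫ c, max (P y - P (y.1, c)) 0 ∂ν) (μ.prod ν) :=
    integrable_of_bounds (measurable_integral_resample hP) 0 1 fun y =>
      integral_mem_Icc fun c => hin _ _
  have hPI : Integrable P (μ.prod ν) := integrable_of_bounds hP 0 1 fun z => ⟨hP0 z, hP1 z⟩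
  rw [← integral_const_mul, integral_prod _ (hPI.const_mul _)]
  refine integral_mono_ae (hPI.const_mul _).integral_prod_left hmid.integral_prod_left ?_
  filter_upwards [h1] with ω hω
  have hPi : Integrable (fun c => P (ω, c)) ν :=
    integrable_of_bounds (hP.comp measurable_prodMk_left) 0 1 fun c => ⟨hP0 _, hP1 _⟩
  have hXi : Integrable (fun c => X (ω, c)) ν :=
    integrable_of_bounds (hX.comp measurable_prodMk_left) 0 1 fun c => hX1 _
  rw [integral_sub hXi hPi] at hω
  have hβ0 : 0 ≤ ∫ c, P (ω, c) ∂ν := integral_nonneg fun c => hP0 _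
  have hβv : ∫ c, P (ω, c) ∂ν ≤ v := by
    have := integral_mono (μ := ν) hPi (integrable_const v) fun c =>
      (hPX (ω, c)).trans (by nlinarith [(hX1 (ω, c)).2])
    simpa using this
  have hle : (∫ c, P (ω, c) ∂ν) * (1 - ∫ c, X (ω, c) ∂ν)
      ≤ ∫ c', ∫ c, max (P (ω, c') - P (ω, c)) 0 ∂ν ∂ν := by
    have hIi : Integrable (fun c' => ∫ c, max (P (ω, c') - P (ω, c)) 0 ∂ν) ν :=
      integrable_of_bounds ((measurable_integral_resample hP).comp measurable_prodMk_left) 0 1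
        fun c' => integral_mem_Icc fun c => hin _ _
    rw [← integral_mul_const]
    refine integral_mono (hPi.mul_const _) hIi fun c' => ?_
    have : P (ω, c') * (1 - ∫ c, X (ω, c) ∂ν) = ∫ c, P (ω, c') * (1 - X (ω, c)) ∂ν := by
      rw [integral_const_mul, integral_sub (integrable_const _) hXi]; simp
    show P (ω, c') * (1 - ∫ c, X (ω, c) ∂ν) ≤ _
    rw [this]
    refine integral_mono (((integrable_const _).sub hXi).const_mul _)
      (integrable_of_bounds (by fun_prop) 0 1 fun c => hin _ _) fun c => ?_
    show P (ω, c') * (1 - X (ω, c)) ≤ max (P (ω, c') - P (ω, c)) 0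
    rcases hX01 (ω, c) with h | h
    · have := hPX (ω, c)
      rw [h] at this ⊢
      exact le_max_of_le_left (by linarith [hP0 (ω, c)])
    · rw [h]; simp
  show ∫ c, (r - v) * P (ω, c) ∂ν ≤ _
  rw [integral_const_mul]
  refine le_trans ?_ hle
  nlinarith

end Solo

/-! ### Amounts collected from an honest buyer, and the single-buyer game. -/

namespace Protocol

variable {Id : Type} {U : Set ℝ} (A : Protocol Id U)

open scoped Classical in
/-- The payment collected from an honest buyer that is sent the decision and outcome `d`. -/
noncomputable def paid (a : Id) (v : U) (ω : A.BuyerCoin) (d : Bool × Outcome) : ℝ :=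
  if d.1 = true ∧ A.accept a v ω d.2 then (d.2.2 : ℝ) else 0

open scoped Classical in
/-- The number of items obtained by an honest buyer that is sent the decision and outcome `d`. -/
noncomputable def got (a : Id) (v : U) (ω : A.BuyerCoin) (d : Bool × Outcome) : ℝ :=
  if d.1 = true ∧ A.accept a v ω d.2 then (d.2.1 : ℝ) else 0

/-- What the honest platform sends to the buyer `i`. -/
def reply (I : Finset Id) (m : I → A.Msg) (c : A.PlatformCoin I) (i : I) : Bool × Outcome :=
  ((A.platform I m c).1, (A.platform I m c).2 i)

variable {A}

theorem measurable_reply (I : Finset Id) (i : I) :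
    Measurable fun z : (I → A.Msg) × A.PlatformCoin I => A.reply I z.1 z.2 i :=
  (A.measurable_platform I).fst.prodMk ((measurable_pi_apply i).comp (A.measurable_platform I).snd)

theorem measurableSet_accepted (a : Id) (v : U) :
    MeasurableSet {z : A.BuyerCoin × (Bool × Outcome) | z.2.1 = true ∧ A.accept a v z.1 z.2.2} := by
  have h1 : MeasurableSet {z : A.BuyerCoin × (Bool × Outcome) | z.2.1 = true} :=
    measurable_snd.fst (measurableSet_singleton true)
  have h2 : Measurable fun z : A.BuyerCoin × (Bool × Outcome) => (z.1, z.2.2) := by fun_prop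
  exact h1.inter (h2 (A.measurable_accept a v))

theorem measurable_paid (a : Id) (v : U) :
    Measurable fun z : A.BuyerCoin × (Bool × Outcome) => A.paid a v z.1 z.2 := by
  refine Measurable.ite (measurableSet_accepted a v) ?_ measurable_const
  exact measurable_snd.snd.snd.coe_nnreal_real

theorem measurable_got (a : Id) (v : U) :
    Measurable fun z : A.BuyerCoin × (Bool × Outcome) => A.got a v z.1 z.2 := by
  refine Measurable.ite (measurableSet_accepted a v) ?_ measurable_const
  exact (measurable_of_countable (fun n : ℕ => (n : ℝ))).comp measurable_snd.snd.fst

theorem paid_nonneg (a : Id) (v : U) (ω : A.BuyerCoin) (d : Bool × Outcome) :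
    0 ≤ A.paid a v ω d := by
  unfold paid; split_ifs <;> simp

section Auction

variable [DecidableEq Id] {k : ℕ}

theorem IsAuction.got_eq (hA : A.IsAuction k) (a : Id) (v : U) (ω : A.BuyerCoin)
    (d : Bool × Outcome) : A.got a v ω d = 0 ∨ A.got a v ω d = 1 := by
  unfold got
  split_ifs with h
  · have := (hA.individually_rational a v ω d.2 h.2).1
    interval_cases d.2.1 <;> simp
  · simp

theorem IsAuction.paid_le_mul_got (hA : A.IsAuction k) (a : Id) (v : U) (ω : A.BuyerCoin)
    (d : Bool × Outcome) : A.paid a v ω d ≤ v * A.got a v ω d := by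
  unfold got paid
  split_ifs with h
  · rw [mul_comm]; exact (hA.individually_rational a v ω d.2 h.2).2
  · simp

theorem IsAuction.paid_le (hA : A.IsAuction k) (hU : U ⊆ Set.Icc 0 1) (a : Id) (v : U)
    (ω : A.BuyerCoin) (d : Bool × Outcome) : A.paid a v ω d ≤ v := by
  have h := hA.paid_le_mul_got a v ω d
  have hv := (hU v.2).1
  rcases hA.got_eq a v ω d with h' | h' <;> rw [h'] at h <;> linarith

theorem IsAuction.paid_mem_Icc (hA : A.IsAuction k) (hU : U ⊆ Set.Icc 0 1) (a : Id) (v : U)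
    (ω : A.BuyerCoin) (d : Bool × Outcome) : A.paid a v ω d ∈ Set.Icc (0 : ℝ) 1 :=
  ⟨paid_nonneg a v ω d, (hA.paid_le hU a v ω d).trans (hU v.2).2⟩

end Auction

/-! ### The coalition facing a single buyer -/

/-- What the honest platform sends to `a` if `a` is alone and sends `m`. -/
def soloReply (A : Protocol Id U) (a : Id) (m : A.Msg) (c : A.PlatformCoin {a}) : Bool × Outcome :=
  A.reply {a} (fun _ => m) c ⟨a, Finset.mem_singleton_self a⟩

/-- The payment of the honest buyer `a` in an honest execution without other buyers. -/
noncomputable def soloPaid (A : Protocol Id U) (a : Id) (v : U)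
    (z : A.BuyerCoin × A.PlatformCoin {a}) : ℝ :=
  A.paid a v z.1 (A.soloReply a (A.message a v z.1) z.2)

theorem measurable_soloReply (a : Id) :
    Measurable fun z : A.Msg × A.PlatformCoin {a} => A.soloReply a z.1 z.2 := by
  have : Measurable fun z : A.Msg × A.PlatformCoin {a} =>
      ((fun _ => z.1 : (({a} : Finset Id) → A.Msg)), z.2) :=
    (measurable_pi_lambda _ fun _ => measurable_fst).prodMk measurable_snd
  exact (measurable_reply {a} ⟨a, Finset.mem_singleton_self a⟩).comp this

theorem measurable_soloPaid (a : Id) (v : U) : Measurable (A.soloPaid a v) := by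
  have h : Measurable fun z : A.BuyerCoin × A.PlatformCoin {a} => (A.message a v z.1, z.2) :=
    ((A.measurable_message a v).comp measurable_fst).prodMk measurable_snd
  exact (measurable_paid a v).comp (measurable_fst.prodMk ((measurable_soloReply a).comp h))

theorem measurable_soloUtility_integrand (alt : A.Msg → Bool × Outcome) (halt : Measurable alt)
    (a : Id) (v : U) : Measurable fun z : A.BuyerCoin × A.PlatformCoin {a} =>
      A.paid a v z.1 (alt (A.message a v z.1)) :=
  (measurable_paid a v).comp (measurable_fst.prodMk
    (halt.comp ((A.measurable_message a v).comp measurable_fst)))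

/-- The alternative `alt` if it collects more than the outcome `d`, and `d` otherwise. -/
noncomputable def better (alt d : Bool × Outcome) : Bool × Outcome :=
  if alt.1 = true ∧ d.2.2 < alt.2.2 then alt else d

/-- The expected utility of the coalition against the honest buyer `a` alone when it acts by `act`,
with the coins of the honest platform. -/
noncomputable def soloUtility (A : Protocol Id U) (a : Id) (v : U)
    (act : A.Msg → A.PlatformCoin {a} → Bool × Outcome) : ℝ :=
  ∫ z, A.paid a v z.1 (act (A.message a v z.1) z.2) ∂A.buyerLaw.prod (A.platformLaw {a})

instance (I : Finset Id) : IsProbabilityMeasure (A.coinsLaw I) := by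
  unfold coinsLaw; infer_instance

theorem coinsLaw_singleton (a : Id) :
    MeasurePreserving (fun (x : A.BuyerCoin) (_ : ({a} : Finset Id)) => x) A.buyerLaw
      (A.coinsLaw {a}) :=
  measurePreserving_const_of_unique A.buyerLaw

theorem messages_singleton (a : Id) (b : ({a} : Finset Id) → U) (x : A.BuyerCoin) :
    A.messages b (fun _ => x) = fun _ => A.message a (b default) x := by
  funext i
  rw [Unique.eq_default i]; rfl

theorem measurable_messages {I : Finset Id} (b : I → U) : Measurable (A.messages b) :=
  measurable_pi_lambda _ fun i => (A.measurable_message _ _).comp (measurable_pi_apply i)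

-- The coin space is arbitrary so that the honest platform, the abstract deviation and the circuit
-- attacks are all covered.
open scoped Classical in
theorem integral_singleton {C : Type} [MeasurableSpace C] (ν : Measure C) [IsProbabilityMeasure ν]
    (a : Id) (b : ({a} : Finset Id) → U)
    (act : (({a} : Finset Id) → A.Msg) → C → ({a} : Finset Id) → Bool × Outcome)
    (hact : Measurable fun z : (({a} : Finset Id) → A.Msg) × C => act z.1 z.2) :
    ∫ ω, (if ∀ i : ({a} : Finset Id), (act (A.messages b ω.1) ω.2 i).1 = true ∧
        A.accept i (b i) (ω.1 i) (act (A.messages b ω.1) ω.2 i).2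
      then ∑ i, ((act (A.messages b ω.1) ω.2 i).2.2 : ℝ) else 0) ∂(A.coinsLaw {a}).prod ν =
    ∫ z, A.paid a (b default) z.1 (act (fun _ => A.message a (b default) z.1) z.2 default)
      ∂A.buyerLaw.prod ν := by
  have hmp := (coinsLaw_singleton (A := A) a).prod (MeasurePreserving.id ν)
  have key : ∀ ω : (({a} : Finset Id) → A.BuyerCoin) × C,
      (if ∀ i : ({a} : Finset Id), (act (A.messages b ω.1) ω.2 i).1 = true ∧
        A.accept i (b i) (ω.1 i) (act (A.messages b ω.1) ω.2 i).2
      then ∑ i, ((act (A.messages b ω.1) ω.2 i).2.2 : ℝ) else 0) =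
      A.paid a (b default) (ω.1 default) (act (A.messages b ω.1) ω.2 default) := by
    intro ω
    simp only [Unique.forall_iff, Fintype.sum_unique]
    rfl
  simp_rw [key]
  have hmeas : Measurable fun ω : (({a} : Finset Id) → A.BuyerCoin) × C =>
      A.paid a (b default) (ω.1 default) (act (A.messages b ω.1) ω.2 default) := by
    have h1 : Measurable fun ω : (({a} : Finset Id) → A.BuyerCoin) × C =>
        (A.messages b ω.1, ω.2) :=
      ((measurable_messages b).comp measurable_fst).prodMk measurable_snd
    have h2 : Measurable fun ω : (({a} : Finset Id) → A.BuyerCoin) × C =>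
        act (A.messages b ω.1) ω.2 default := (measurable_pi_apply default).comp (hact.comp h1)
    have h3 : Measurable fun ω : (({a} : Finset Id) → A.BuyerCoin) × C => ω.1 default :=
      (measurable_pi_apply default).comp measurable_fst
    exact (measurable_paid a (b default)).comp (h3.prodMk h2)
  rw [← hmp.map_eq, integral_map hmp.measurable.aemeasurable hmeas.aestronglyMeasurable]
  refine integral_congr_ae (ae_of_all _ fun z => ?_)
  simp only [Prod.map, id, messages_singleton]

/-- The deviation of the coalition that, facing a single buyer, sends it the better of the honest
outcome and of the alternative `alt`, which depends on the buyer's message only. -/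
noncomputable def deviation (A : Protocol Id U) (alt : A.Msg → Bool × Outcome)
    (halt : Measurable alt) : A.PlatformStrategy where
  Coin := A.PlatformCoin
  law := A.platformLaw
  act := fun I m c i => if I.card = 1 then better (alt (m i)) (A.reply I m c i) else (false, 0, 0)
  measurable_act := fun I => measurable_pi_lambda _ fun i => by
    by_cases h : I.card = 1
    · simp only [h, if_true]
      have h1 : Measurable fun z : (I → A.Msg) × A.PlatformCoin I => alt (z.1 i) :=
        halt.comp ((measurable_pi_apply i).comp measurable_fst)
      have h2 := measurable_reply (A := A) I i
      have h3 : MeasurableSet {z : (I → A.Msg) × A.PlatformCoin I |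
          (A.reply I z.1 z.2 i).2.2 < (alt (z.1 i)).2.2} :=
        measurableSet_lt h2.snd.snd h1.snd.snd
      exact Measurable.ite ((h1.fst (measurableSet_singleton true)).inter h3) h1 h2
    · simp only [h, if_false]
      exact measurable_const

theorem coalitionUtility_deviation (alt : A.Msg → Bool × Outcome) (halt : Measurable alt) (a : Id)
    (b : ({a} : Finset Id) → U) :
    A.coalitionUtility (A.deviation alt halt) {a} b =
      A.soloUtility a (b default) fun m c => better (alt m) (A.soloReply a m c) := by
  have := integral_singleton (A := A) (A.platformLaw {a}) a b
    ((A.deviation alt halt).act {a}) ((A.deviation alt halt).measurable_act {a})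
  unfold coalitionUtility soloUtility
  refine this.trans ?_
  simp only [deviation, Finset.card_singleton, if_true]
  rfl

theorem coalitionUtility_honest (a : Id) (b : ({a} : Finset Id) → U) :
    A.coalitionUtility A.honestPlatform {a} b =
      A.soloUtility a (b default) fun m c => A.soloReply a m c :=
  integral_singleton (A := A) (A.platformLaw {a}) a b
    (A.honestPlatform.act {a}) (A.honestPlatform.measurable_act {a})

end Protocol

/-- Refreshing the coins of one buyer does not change the law of an execution. The idle factor `τ`
leaves room for the platform coins of a solo execution that uses the same fresh buyer coins, which
is the coupling behind `gap`. -/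
theorem measurePreserving_update_fst {ι α γ δ : Type*} [Fintype ι] [DecidableEq ι]
    [MeasurableSpace α] [MeasurableSpace γ] [MeasurableSpace δ] (μ : Measure α)
    [IsProbabilityMeasure μ] (ρ : Measure γ) [IsProbabilityMeasure ρ] (τ : Measure δ)
    [IsProbabilityMeasure τ] (i : ι) :
    MeasurePreserving (fun z : ((ι → α) × γ) × (α × δ) => (Function.update z.1.1 i z.2.1, z.1.2))
      (((Measure.pi fun _ => μ).prod ρ).prod (μ.prod τ)) ((Measure.pi fun _ => μ).prod ρ) := by
  have h1 := (MeasurePreserving.id ((Measure.pi fun _ : ι => μ).prod ρ)).prod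
    (measurePreserving_fst (μ := μ) (ν := τ))
  have h2 := measurePreserving_prodAssoc (Measure.pi fun _ : ι => μ) ρ μ
  have h3 := (MeasurePreserving.id (Measure.pi fun _ : ι => μ)).prod
    (Measure.measurePreserving_swap (μ := ρ) (ν := μ))
  have h4 := (measurePreserving_prodAssoc (Measure.pi fun _ : ι => μ) μ ρ).symm
  have h5 := (measurePreserving_update μ i).prod (MeasurePreserving.id ρ)
  exact h5.comp (h4.comp (h3.comp (h2.comp h1)))

/-- The part of a payment `p` of a buyer with value `v` that a posted price `r` does not explain. -/
noncomputable def excess (r v p : ℝ) : ℝ := if v < r then p else max (p - r) 0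

theorem measurable_excess (r v : ℝ) : Measurable (excess r v) := by
  unfold excess; split_ifs <;> fun_prop

/-- In both branches `excess` is nondecreasing and 1-Lipschitz in the payment. Here `q` will be a
payment among competitors and `p` the coupled solo payment. -/
theorem excess_le_add (r v p q : ℝ) : excess r v q ≤ max (q - p) 0 + excess r v p := by
  unfold excess
  split_ifs
  · linarith [le_max_left (q - p) 0]
  · refine max_le ?_ (add_nonneg (le_max_right _ _) (le_max_right _ _))
    linarith [le_max_left (q - p) 0, le_max_left (p - r) 0]

theorem excess_mem_Icc {r v p : ℝ} (hr : 0 ≤ r) (hp : p ∈ Set.Icc (0 : ℝ) 1) :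
    excess r v p ∈ Set.Icc (0 : ℝ) 1 := by
  unfold excess
  split_ifs
  · exact hp
  · exact ⟨le_max_right _ _, max_le (by linarith [hp.2]) zero_le_one⟩

/-! ### The gain of the single-buyer deviation. -/

namespace Protocol

variable {Id : Type} [DecidableEq Id] {U : Set ℝ} {A : Protocol Id U} {k : ℕ}

theorem IsAuction.deviation_feasible (hA : A.IsAuction k) (alt : A.Msg → Bool × Outcome)
    (halt : Measurable alt) (hk : ∀ m, (alt m).1 = true → (alt m).2.1 ≤ k) :
    (A.deviation alt halt).Feasible k := by
  intro I m c
  by_cases h : I.card = 1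
  · obtain ⟨j, rfl⟩ := Finset.card_eq_one.1 h
    rw [Fintype.sum_unique]
    simp only [deviation, Finset.card_singleton, if_true]
    split_ifs with hd
    · unfold better at hd ⊢
      split_ifs at hd ⊢ with h'
      · exact hk _ h'.1
      · have := hA.capacity {j} m c hd
        rwa [Fintype.sum_unique] at this
    · exact Nat.zero_le _
  · simp [deviation, h]

theorem IsAuction.ae_soloReply (hA : A.IsAuction k) (a : Id) (v : U) :
    ∀ᵐ z ∂A.buyerLaw.prod (A.platformLaw {a}),
      (A.soloReply a (A.message a v z.1) z.2).1 = true ∧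
        A.accept a v z.1 (A.soloReply a (A.message a v z.1) z.2).2 := by
  have hmp := (coinsLaw_singleton (A := A) a).prod (MeasurePreserving.id (A.platformLaw {a}))
  filter_upwards [hmp.quasiMeasurePreserving.ae (hA.completeness {a} fun _ => v)] with z hz
  simp only [Prod.map, id, messages_singleton] at hz
  exact ⟨hz.1, hz.2 default⟩

/-- Whenever it is not `⊥`, the alternative is accepted almost surely, as is the honest reply, so
comparing the announced prices is the same as comparing the collected payments, and the deviation
collects their maximum. -/
theorem IsAuction.soloUtility_better_sub (hA : A.IsAuction k) (hU : U ⊆ Set.Icc 0 1)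
    (alt : A.Msg → Bool × Outcome) (halt : Measurable alt) (a : Id) (v : U)
    (hacc : ∀ᵐ ω ∂A.buyerLaw, (alt (A.message a v ω)).1 = true →
      A.accept a v ω (alt (A.message a v ω)).2) :
    A.soloUtility a v (fun m c => better (alt m) (A.soloReply a m c)) -
        A.soloUtility a v (fun m c => A.soloReply a m c) =
      ∫ z, max (A.paid a v z.1 (alt (A.message a v z.1)) - A.soloPaid a v z) 0
        ∂A.buyerLaw.prod (A.platformLaw {a}) := by
  have hm1 := measurable_soloUtility_integrand alt halt a v
  have hm2 := measurable_soloPaid (A := A) a v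
  have hP1 := fun z : A.BuyerCoin × A.PlatformCoin {a} =>
    hA.paid_mem_Icc hU a v z.1 (alt (A.message a v z.1))
  have hP2 : ∀ z, A.soloPaid a v z ∈ Set.Icc (0 : ℝ) 1 := fun z => hA.paid_mem_Icc hU a v z.1 _
  have hi2 : Integrable (A.soloPaid a v) (A.buyerLaw.prod (A.platformLaw {a})) :=
    integrable_of_bounds hm2 0 1 hP2
  have hi1 : Integrable (fun z : A.BuyerCoin × A.PlatformCoin {a} =>
      max (A.paid a v z.1 (alt (A.message a v z.1)) - A.soloPaid a v z) 0)
      (A.buyerLaw.prod (A.platformLaw {a})) :=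
    integrable_of_bounds (by fun_prop) 0 1 fun z =>
      ⟨le_max_right _ _, max_le (by linarith [(hP1 z).2, (hP2 z).1]) zero_le_one⟩
  rw [sub_eq_iff_eq_add]
  have : A.soloUtility a v (fun m c => A.soloReply a m c) =
    ∫ z, A.soloPaid a v z ∂A.buyerLaw.prod (A.platformLaw {a}) := rfl
  rw [this, ← integral_add hi1 hi2]
  have hacc' : ∀ᵐ z ∂A.buyerLaw.prod (A.platformLaw {a}), (alt (A.message a v z.1)).1 = true →
      A.accept a v z.1 (alt (A.message a v z.1)).2 :=
    measurePreserving_fst.quasiMeasurePreserving.ae hacc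
  refine integral_congr_ae ?_
  filter_upwards [hacc', hA.ae_soloReply a v] with z hz hz'
  have hs : A.soloPaid a v z = ((A.soloReply a (A.message a v z.1) z.2).2.2 : ℝ) := if_pos hz'
  by_cases h1 : (alt (A.message a v z.1)).1 = true
  · have ha : A.paid a v z.1 (alt (A.message a v z.1)) = ((alt (A.message a v z.1)).2.2 : ℝ) :=
      if_pos ⟨h1, hz h1⟩
    by_cases h2 : (A.soloReply a (A.message a v z.1) z.2).2.2 < (alt (A.message a v z.1)).2.2
    · rw [show better (alt (A.message a v z.1)) (A.soloReply a (A.message a v z.1) z.2)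
        = alt (A.message a v z.1) from if_pos ⟨h1, h2⟩, ha, hs, max_eq_left]
      · ring
      · exact sub_nonneg.2 (NNReal.coe_le_coe.2 h2.le)
    · rw [show better (alt (A.message a v z.1)) (A.soloReply a (A.message a v z.1) z.2)
        = A.soloReply a (A.message a v z.1) z.2 from if_neg fun h => h2 h.2, ha, hs, max_eq_right,
        zero_add]
      · exact hs
      · exact sub_nonpos.2 (NNReal.coe_le_coe.2 (not_lt.1 h2))
  · have ha : A.paid a v z.1 (alt (A.message a v z.1)) = 0 := if_neg fun h => h1 h.1
    rw [show better (alt (A.message a v z.1)) (A.soloReply a (A.message a v z.1) z.2)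
        = A.soloReply a (A.message a v z.1) z.2 from if_neg fun h => h1 h.1, ha, max_eq_right,
        zero_add]
    · rfl
    · linarith [(hP2 z).1]

/-! ### Simulating the other buyers -/

/-- What the honest platform with coins `c` sends to `i` when `i` sends `x` and the others send the
messages `m`. -/
def simReply (A : Protocol Id U) (I : Finset Id) (m : I → A.Msg) (c : A.PlatformCoin I) (i : I)
    (x : A.Msg) : Bool × Outcome :=
  A.reply I (Function.update m i x) c i

theorem measurable_simReply_joint (I : Finset Id) (i : I) :
    Measurable fun z : ((I → A.Msg) × A.PlatformCoin I) × A.Msg =>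
      A.simReply I z.1.1 z.1.2 i z.2 := by
  have h1 : Measurable fun z : ((I → A.Msg) × A.PlatformCoin I) × A.Msg =>
      (Function.update z.1.1 i z.2, z.1.2) := by
    refine Measurable.prodMk (measurable_pi_lambda _ fun j => ?_) measurable_fst.snd
    by_cases h : j = i
    · subst h; simpa using measurable_snd
    · simp only [Function.update_of_ne h]
      exact (measurable_pi_apply j).comp measurable_fst.fst
  exact (measurable_reply I i).comp h1

theorem measurable_simReply (I : Finset Id) (m : I → A.Msg) (c : A.PlatformCoin I) (i : I) :
    Measurable (A.simReply I m c i) :=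
  (measurable_simReply_joint I i).comp (measurable_prodMk_left (x := (m, c)))

theorem IsAuction.simReply_le (hA : A.IsAuction k) (I : Finset Id) (m : I → A.Msg)
    (c : A.PlatformCoin I) (i : I) (x : A.Msg) (h : (A.simReply I m c i x).1 = true) :
    (A.simReply I m c i x).2.1 ≤ k :=
  (Finset.single_le_sum (f := fun j => ((A.platform I (Function.update m i x) c).2 j).1)
    (fun _ _ => Nat.zero_le _) (Finset.mem_univ i)).trans (hA.capacity I _ c h)

/-- The advantage of the coalition against the single honest buyer `i` when its alternative is what
the honest platform would send to `i` if the others had sent `m` and its coins were `c`. -/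
noncomputable def simAdvantage (A : Protocol Id U) (I : Finset Id) (m : I → A.Msg)
    (c : A.PlatformCoin I) (i : I) (v : U) : ℝ :=
  A.soloUtility i v (fun x c' => better (A.simReply I m c i x) (A.soloReply i x c')) -
    A.soloUtility i v (fun x c' => A.soloReply i x c')

/-- The difference between what `i` pays when it faces honest competitors and what it pays alone,
where positive. -/
noncomputable def overpay (A : Protocol Id U) (I : Finset Id) (b : I → U) (i : I)
    (y : (I → A.BuyerCoin) × A.PlatformCoin I) (z : A.BuyerCoin × A.PlatformCoin {i.1}) : ℝ :=
  max (A.paid i (b i) z.1 (A.simReply I (A.messages b y.1) y.2 i (A.message i (b i) z.1)) -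
    A.soloPaid i (b i) z) 0

/-- The expectation of `overpay`. -/
noncomputable def gap (A : Protocol Id U) (I : Finset Id) (b : I → U) (i : I) : ℝ :=
  ∫ y, ∫ z, A.overpay I b i y z ∂A.buyerLaw.prod (A.platformLaw {i.1})
    ∂(A.coinsLaw I).prod (A.platformLaw I)

theorem measurable_paid_simReply (I : Finset Id) (b : I → U) (i : I) :
    Measurable fun w : ((I → A.BuyerCoin) × A.PlatformCoin I) ×
        (A.BuyerCoin × A.PlatformCoin {i.1}) =>
      A.paid i (b i) w.2.1
        (A.simReply I (A.messages b w.1.1) w.1.2 i (A.message i (b i) w.2.1)) := by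
  have h1 : Measurable fun w : ((I → A.BuyerCoin) × A.PlatformCoin I) ×
      (A.BuyerCoin × A.PlatformCoin {i.1}) =>
      (((A.messages b w.1.1, w.1.2), A.message i (b i) w.2.1) :
        ((I → A.Msg) × A.PlatformCoin I) × A.Msg) :=
    (((measurable_messages b).comp measurable_fst.fst).prodMk measurable_fst.snd).prodMk
      ((A.measurable_message _ _).comp measurable_snd.fst)
  exact (measurable_paid _ _).comp
    (measurable_snd.fst.prodMk ((measurable_simReply_joint I i).comp h1))

theorem measurable_overpay (I : Finset Id) (b : I → U) (i : I) :
    Measurable fun w : ((I → A.BuyerCoin) × A.PlatformCoin I) ×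
        (A.BuyerCoin × A.PlatformCoin {i.1}) => A.overpay I b i w.1 w.2 :=
  ((measurable_paid_simReply I b i).sub ((measurable_soloPaid _ _).comp measurable_snd)).max
    measurable_const

theorem IsAuction.overpay_mem_Icc (hA : A.IsAuction k) (hU : U ⊆ Set.Icc 0 1) (I : Finset Id)
    (b : I → U) (i : I) (y : (I → A.BuyerCoin) × A.PlatformCoin I)
    (z : A.BuyerCoin × A.PlatformCoin {i.1}) : A.overpay I b i y z ∈ Set.Icc (0 : ℝ) 1 :=
  ⟨le_max_right _ _, max_le (by
    have h1 := (hA.paid_mem_Icc hU i (b i) z.1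
      (A.simReply I (A.messages b y.1) y.2 i (A.message i (b i) z.1))).2
    have h2 : 0 ≤ A.soloPaid i (b i) z := paid_nonneg _ _ _ _
    linarith) zero_le_one⟩

theorem gap_nonneg (I : Finset Id) (b : I → U) (i : I) : 0 ≤ A.gap I b i :=
  integral_nonneg fun _ => integral_nonneg fun _ => le_max_right _ _

theorem messages_update {I : Finset Id} (b : I → U) (ω : I → A.BuyerCoin) (i : I)
    (x : A.BuyerCoin) : A.messages b (Function.update ω i x) =
      Function.update (A.messages b ω) i (A.message i (b i) x) := by
  funext j
  by_cases h : j = i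
  · subst h; simp [messages]
  · simp [messages, h]

/-- The message of `i` in the simulated profile is overwritten by the real one. The deviation is
therefore the same for every value of its target, which allows averaging over that value. -/
theorem simReply_messages_update {I : Finset Id} (b : I → U) (ω : I → A.BuyerCoin)
    (c : A.PlatformCoin I) (i : I) (v : U) :
    A.simReply I (A.messages (Function.update b i v) ω) c i =
      A.simReply I (A.messages b ω) c i := by
  funext x
  unfold simReply
  congr 1
  funext j
  by_cases h : j = i
  · subst h; simp
  · simp [messages, h]

/-- The simulated execution with a fresh real message of `i` has the law of an honest execution, so
completeness transfers to it. -/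
theorem IsAuction.ae_simReply_accept (hA : A.IsAuction k) (I : Finset Id) (b : I → U) (i : I) :
    ∀ᵐ y ∂(A.coinsLaw I).prod (A.platformLaw I), ∀ᵐ ω ∂A.buyerLaw,
      A.accept i (b i) ω
        (A.simReply I (A.messages b y.1) y.2 i (A.message i (b i) ω)).2 := by
  have hmp := measurePreserving_update_fst A.buyerLaw (A.platformLaw I) A.buyerLaw i
  have h := Measure.ae_ae_of_ae_prod
    (hmp.quasiMeasurePreserving.ae (hA.completeness I b))
  filter_upwards [h] with y hy
  filter_upwards [Measure.ae_ae_of_ae_prod hy] with ω hω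
  obtain ⟨_, hω⟩ := hω.exists
  have := hω.2 i
  rwa [Function.update_self, messages_update] at this

/-- By Fubini, `gap` is the average of `simAdvantage` over honestly drawn messages and coins. A
bound for each fixed choice of these therefore suffices. The weights `w` treat together a single
value (ex post) and a distribution of values (Bayesian). -/
theorem IsAuction.sum_mul_gap_le (hA : A.IsAuction k) (hU : U ⊆ Set.Icc 0 1) (I : Finset Id)
    (b : I → U) (i : I) (s : Finset U) (w : U → ℝ) {ε : ℝ}
    (h : ∀ m c, ∑ v ∈ s, w v * A.simAdvantage I m c i v ≤ ε) :
    ∑ v ∈ s, w v * A.gap I (Function.update b i v) i ≤ ε := by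
  have hint : ∀ v, Integrable (fun y => ∫ z, A.overpay I (Function.update b i v) i y z
      ∂A.buyerLaw.prod (A.platformLaw {i.1})) ((A.coinsLaw I).prod (A.platformLaw I)) := fun v =>
    integrable_of_bounds
      (measurable_overpay I _ i).stronglyMeasurable.integral_prod_right.measurable 0 1
      fun y => integral_mem_Icc fun z => hA.overpay_mem_Icc hU I _ i y z
  have hpull : ∀ v, w v * A.gap I (Function.update b i v) i =
      ∫ y, w v * ∫ z, A.overpay I (Function.update b i v) i y z
        ∂A.buyerLaw.prod (A.platformLaw {i.1}) ∂(A.coinsLaw I).prod (A.platformLaw I) :=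
    fun v => (integral_const_mul _ _).symm
  simp only [hpull]
  rw [← integral_finsetSum _ fun v _ => (hint v).const_mul _]
  have hae : ∀ᵐ y ∂(A.coinsLaw I).prod (A.platformLaw I), ∀ v ∈ s, ∀ᵐ ω ∂A.buyerLaw,
      A.accept i v ω (A.simReply I (A.messages b y.1) y.2 i (A.message i v ω)).2 := by
    rw [eventually_all_finset]
    intro v _
    filter_upwards [hA.ae_simReply_accept I (Function.update b i v) i] with y hy
    simpa only [simReply_messages_update, Function.update_self] using hy
  have hle : ∀ᵐ y ∂(A.coinsLaw I).prod (A.platformLaw I),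
      ∑ v ∈ s, w v * ∫ z, A.overpay I (Function.update b i v) i y z
        ∂A.buyerLaw.prod (A.platformLaw {i.1}) ≤ ε := by
    filter_upwards [hae] with y hy
    refine le_trans (le_of_eq (Finset.sum_congr rfl fun v hv => ?_)) (h (A.messages b y.1) y.2)
    congr 1
    have := hA.soloUtility_better_sub hU (A.simReply I (A.messages b y.1) y.2 i)
      (measurable_simReply I _ _ i) i v ((hy v hv).mono fun _ h _ => h)
    unfold simAdvantage
    rw [this]
    simp only [overpay, simReply_messages_update, Function.update_self]
  simpa using integral_mono_ae (integrable_finsetSum _ fun v _ => (hint v).const_mul (w v))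
    (integrable_const ε) hle

end Protocol

namespace Protocol

variable {Id : Type} {U : Set ℝ} {A : Protocol Id U}

/-- The expected part of the payment of the single buyer `a` that the posted price `r` does not
explain. -/
noncomputable def soloExcess (A : Protocol Id U) (r : ℝ) (a : Id) (v : U) : ℝ :=
  ∫ z, excess r v (A.soloPaid a v z) ∂A.buyerLaw.prod (A.platformLaw {a})

section

variable [DecidableEq Id] {k : ℕ}

/-! ### Comparing the revenue with a posted price -/

-- Only buyers in `T`, who have value at least `r` and an item, are charged the posted price; `T` is
-- bounded both by the capacity and by the demand. Below `r` the whole payment counts as excess, and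
-- without an item individual rationality forces payment zero.
open scoped Classical in
theorem IsAuction.sum_paid_le (hA : A.IsAuction k) (r : ℝ≥0) (I : Finset Id) (b : I → U)
    (ω : I → A.BuyerCoin) (m : I → A.Msg) (c : A.PlatformCoin I) :
    ∑ i : I, A.paid i (b i) (ω i) (A.reply I m c i) ≤
      postedRevenue k r b + ∑ i : I, excess r (b i) (A.paid i (b i) (ω i) (A.reply I m c i)) := by
  set T : Finset I := Finset.univ.filter fun i => (r : ℝ) ≤ (b i : ℝ) ∧
    (A.platform I m c).1 = true ∧ 1 ≤ ((A.platform I m c).2 i).1 with hT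
  have hTk : T.card ≤ k := by
    by_cases hacc : (A.platform I m c).1 = true
    · refine le_trans ?_ (hA.capacity I m c hacc)
      rw [Finset.card_eq_sum_ones]
      exact (Finset.sum_le_sum fun i hi => (Finset.mem_filter.1 hi).2.2.2).trans
        (Finset.sum_le_univ_sum_of_nonneg fun _ => Nat.zero_le _)
    · simp [hT, hacc]
  have hTb : T.card ≤ (Finset.univ.filter fun i => (r : ℝ) ≤ (b i : ℝ)).card :=
    Finset.card_le_card fun i hi => by
      simp only [hT, Finset.mem_filter] at hi ⊢
      exact ⟨hi.1, hi.2.1⟩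
  have hpt : ∀ i : I, A.paid i (b i) (ω i) (A.reply I m c i) ≤
      (if i ∈ T then (r : ℝ) else 0) +
        excess r (b i) (A.paid i (b i) (ω i) (A.reply I m c i)) := by
    intro i
    by_cases hv : (b i : ℝ) < r
    · have : (0 : ℝ) ≤ if i ∈ T then (r : ℝ) else 0 := by split_ifs <;> simp
      simp only [excess, hv, if_true]
      linarith
    · by_cases hi : i ∈ T
      · simp only [excess, hv, hi, if_true, if_false]
        linarith [le_max_left (A.paid i (b i) (ω i) (A.reply I m c i) - r) 0]
      · have h0 : A.paid i (b i) (ω i) (A.reply I m c i) ≤ 0 := by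
          unfold paid
          split_ifs with h
          · have hx := hA.individually_rational _ _ _ _ h.2
            have : (A.reply I m c i).2.1 = 0 := by
              by_contra hne
              exact hi (Finset.mem_filter.2
                ⟨Finset.mem_univ _, not_lt.1 hv, h.1, Nat.one_le_iff_ne_zero.2 hne⟩)
            simpa [this] using hx.2
          · exact le_rfl
        simp only [excess, hv, hi, if_false]
        linarith [le_max_right (A.paid i (b i) (ω i) (A.reply I m c i) - r) 0]
  refine (Finset.sum_le_sum fun i _ => hpt i).trans ?_
  rw [Finset.sum_add_distrib]
  gcongr
  rw [← Finset.sum_filter, Finset.sum_const, nsmul_eq_mul, mul_comm]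
  unfold postedRevenue
  refine mul_le_mul_of_nonneg_left ?_ r.2
  rw [show (Finset.univ.filter fun i => i ∈ T) = T by ext; simp]
  exact_mod_cast le_min hTk hTb

/-- After refreshing the coins of `i`, the payment among competitors is coupled with a solo payment,
and `excess_le_add` applies pointwise. -/
theorem IsAuction.integral_excess_paid_le (hA : A.IsAuction k) (hU : U ⊆ Set.Icc 0 1) (r : ℝ≥0)
    (I : Finset Id) (b : I → U) (i : I) :
    ∫ y, excess r (b i) (A.paid i (b i) (y.1 i) (A.reply I (A.messages b y.1) y.2 i))
        ∂(A.coinsLaw I).prod (A.platformLaw I) ≤ A.gap I b i + A.soloExcess r i (b i) := by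
  have hmp := measurePreserving_update_fst A.buyerLaw (A.platformLaw I) (A.platformLaw {i.1}) i
  have hmeas : Measurable fun y : (I → A.BuyerCoin) × A.PlatformCoin I =>
      excess r (b i) (A.paid i (b i) (y.1 i) (A.reply I (A.messages b y.1) y.2 i)) := by
    have h1 : Measurable fun y : (I → A.BuyerCoin) × A.PlatformCoin I =>
        A.reply I (A.messages b y.1) y.2 i :=
      (measurable_reply I i).comp (((measurable_messages b).comp measurable_fst).prodMk
        measurable_snd)
    exact (measurable_excess _ _).comp ((measurable_paid _ _).comp
      (((measurable_pi_apply i).comp measurable_fst).prodMk h1))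
  have hpaid := fun w : ((I → A.BuyerCoin) × A.PlatformCoin I) ×
      (A.BuyerCoin × A.PlatformCoin {i.1}) => hA.paid_mem_Icc hU i (b i) w.2.1
        (A.simReply I (A.messages b w.1.1) w.1.2 i (A.message i (b i) w.2.1))
  have hsolo : ∀ z, A.soloPaid i (b i) z ∈ Set.Icc (0 : ℝ) 1 := fun z =>
    hA.paid_mem_Icc hU _ _ _ _
  set ρ := ((A.coinsLaw I).prod (A.platformLaw I)).prod (A.buyerLaw.prod (A.platformLaw {i.1}))
    with hρ
  have hi1 : Integrable (fun w : ((I → A.BuyerCoin) × A.PlatformCoin I) ×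
      (A.BuyerCoin × A.PlatformCoin {i.1}) => A.overpay I b i w.1 w.2) ρ :=
    integrable_of_bounds (measurable_overpay I b i) 0 1 fun w => hA.overpay_mem_Icc hU I b i _ _
  have hi2 : Integrable (fun z => excess r (b i) (A.soloPaid i (b i) z))
      (A.buyerLaw.prod (A.platformLaw {i.1})) :=
    integrable_of_bounds ((measurable_excess _ _).comp (measurable_soloPaid _ _)) 0 1
      fun z => excess_mem_Icc r.2 (hsolo z)
  have hi3 : Integrable (fun w : ((I → A.BuyerCoin) × A.PlatformCoin I) ×
      (A.BuyerCoin × A.PlatformCoin {i.1}) => excess r (b i) (A.soloPaid i (b i) w.2)) ρ :=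
    hi2.comp_snd _
  have hlhs : ∫ y, excess r (b i) (A.paid i (b i) (y.1 i) (A.reply I (A.messages b y.1) y.2 i))
        ∂(A.coinsLaw I).prod (A.platformLaw I) =
      ∫ w, excess r (b i) (A.paid i (b i) w.2.1
        (A.simReply I (A.messages b w.1.1) w.1.2 i (A.message i (b i) w.2.1))) ∂ρ := by
    refine (hmp.integral_comp_measurable hmeas).trans (integral_congr_ae (ae_of_all _ fun w => ?_))
    simp only [Function.update_self, messages_update]
    rfl
  rw [hlhs]
  calc _ ≤ ∫ w, (A.overpay I b i w.1 w.2 + excess r (b i) (A.soloPaid i (b i) w.2)) ∂ρ :=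
        integral_mono (integrable_of_bounds ((measurable_excess _ _).comp
          (measurable_paid_simReply I b i)) 0 1 fun w => excess_mem_Icc r.2 (hpaid w))
          (hi1.add hi3) fun w => excess_le_add _ _ _ _
    _ = _ := by
        rw [integral_add hi1 hi3, integral_prod _ hi1, integral_prod _ hi3]
        simp [gap, soloExcess]

theorem IsAuction.revenue_le (hA : A.IsAuction k) (hU : U ⊆ Set.Icc 0 1) (r : ℝ≥0)
    (I : Finset Id) (b : I → U) :
    A.revenue I b ≤ postedRevenue k r b + ∑ i, (A.gap I b i + A.soloExcess r i (b i)) := by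
  have hmeas : ∀ i : I, Measurable fun y : (I → A.BuyerCoin) × A.PlatformCoin I =>
      A.paid i (b i) (y.1 i) (A.reply I (A.messages b y.1) y.2 i) := fun i => by
    have h1 : Measurable fun y : (I → A.BuyerCoin) × A.PlatformCoin I =>
        A.reply I (A.messages b y.1) y.2 i :=
      (measurable_reply I i).comp (((measurable_messages b).comp measurable_fst).prodMk
        measurable_snd)
    exact (measurable_paid _ _).comp (((measurable_pi_apply i).comp measurable_fst).prodMk h1)
  have hrev : A.revenue I b = ∫ y, ∑ i : I, A.paid i (b i) (y.1 i)
      (A.reply I (A.messages b y.1) y.2 i) ∂(A.coinsLaw I).prod (A.platformLaw I) := by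
    refine integral_congr_ae ?_
    filter_upwards [hA.completeness I b] with y hy
    rw [if_pos hy.1]
    exact Finset.sum_congr rfl fun i _ => (if_pos ⟨hy.1, hy.2 i⟩).symm
  have hi : ∀ i : I, Integrable (fun y : (I → A.BuyerCoin) × A.PlatformCoin I =>
      A.paid i (b i) (y.1 i) (A.reply I (A.messages b y.1) y.2 i))
      ((A.coinsLaw I).prod (A.platformLaw I)) := fun i =>
    integrable_of_bounds (hmeas i) 0 1 fun y => hA.paid_mem_Icc hU _ _ _ _
  have hi' : ∀ i : I, Integrable (fun y : (I → A.BuyerCoin) × A.PlatformCoin I =>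
      excess r (b i) (A.paid i (b i) (y.1 i) (A.reply I (A.messages b y.1) y.2 i)))
      ((A.coinsLaw I).prod (A.platformLaw I)) := fun i =>
    integrable_of_bounds ((measurable_excess _ _).comp (hmeas i)) 0 1
      fun y => excess_mem_Icc r.2 (hA.paid_mem_Icc hU _ _ _ _)
  rw [hrev]
  calc _ ≤ ∫ y, (postedRevenue k r b + ∑ i : I, excess r (b i) (A.paid i (b i) (y.1 i)
        (A.reply I (A.messages b y.1) y.2 i))) ∂(A.coinsLaw I).prod (A.platformLaw I) :=
        integral_mono (integrable_finsetSum _ fun i _ => hi i)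
          ((integrable_const _).add (integrable_finsetSum _ fun i _ => hi' i))
          fun y => hA.sum_paid_le r I b y.1 _ y.2
    _ = postedRevenue k r b + ∑ i : I, ∫ y, excess r (b i) (A.paid i (b i) (y.1 i)
        (A.reply I (A.messages b y.1) y.2 i)) ∂(A.coinsLaw I).prod (A.platformLaw I) := by
        rw [integral_add (integrable_const _) (integrable_finsetSum _ fun i _ => hi' i),
          integral_finsetSum _ fun i _ => hi' i]
        simp
    _ ≤ _ := by
        gcongr with i
        exact hA.integral_excess_paid_le hU r I b i

/-! ### Independence of the identity -/

/-- Weak symmetry speaks only about outcome laws, so the excess has to be expressed through one;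
completeness permits replacing the collected payment by the announced one. -/
theorem IsAuction.soloExcess_eq (hA : A.IsAuction k) (r : ℝ) (a : Id) (v : U) :
    A.soloExcess r a v =
      ∫ o, excess r v (o default).2 ∂A.outcomeLaw {a} (fun _ => v) := by
  have hmp := (coinsLaw_singleton (A := A) a).prod (MeasurePreserving.id (A.platformLaw {a}))
  have h1 : Measurable fun ω : (({a} : Finset Id) → A.BuyerCoin) × A.PlatformCoin {a} =>
      (A.platform {a} (A.messages (fun _ => v) ω.1) ω.2).2 :=
    ((A.measurable_platform {a}).comp
      (((measurable_messages _).comp measurable_fst).prodMk measurable_snd)).snd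
  have h2 : Measurable fun o : ({a} : Finset Id) → Outcome =>
      excess r v ((o default).2 : ℝ) :=
    (measurable_excess _ _).comp (measurable_pi_apply default).snd.coe_nnreal_real
  have h3 : Measurable fun ω : (({a} : Finset Id) → A.BuyerCoin) × A.PlatformCoin {a} =>
      excess r v (((A.platform {a} (A.messages (fun _ => v) ω.1) ω.2).2 default).2 : ℝ) :=
    h2.comp h1
  unfold outcomeLaw
  rw [integral_map h1.aemeasurable h2.aestronglyMeasurable, ← hmp.map_eq,
    integral_map hmp.measurable.aemeasurable h3.aestronglyMeasurable]
  refine integral_congr_ae ?_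
  filter_upwards [hA.ae_soloReply a v] with z hz
  rw [show A.soloPaid a v z = _ from if_pos hz]
  simp only [Prod.map, id, messages_singleton]
  rfl

/-- With one participant there is only one ordering, so the tie-breaking rule, the only place where
the identity could enter, is trivial. A variable `n` stands for the cardinality so that it can be
substituted. -/
theorem sum_smul_map_of_card_eq_one {a : Id} {n : ℕ} (hn : n = 1)
    (τ : PMF (Fin n ≃ ({a} : Finset Id))) (G : ∀ n : ℕ, (Fin n → U) → Measure (Fin n → Outcome))
    (v : U) :
    ∑ σ : Fin n ≃ ({a} : Finset Id), (τ σ) • (G n fun _ => v).map (fun o i => o (σ.symm i)) =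
      (G 1 fun _ => v).map fun o _ => o 0 := by
  subst hn
  let σ₀ : Fin 1 ≃ ({a} : Finset Id) := Equiv.ofUnique _ _
  have hτ : τ σ₀ = 1 := by
    have h1 : ∑ σ : Fin 1 ≃ ({a} : Finset Id), τ σ = 1 := by
      have := τ.tsum_coe
      rwa [tsum_fintype] at this
    rwa [Fintype.sum_subsingleton _ σ₀] at h1
  rw [Fintype.sum_subsingleton _ σ₀, hτ, one_smul]
  congr 1

theorem WeaklySymmetric.soloExcess_congr (hS : A.WeaklySymmetric) (hA : A.IsAuction k) (r : ℝ)
    (a a' : Id) (v : U) : A.soloExcess r a v = A.soloExcess r a' v := by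
  obtain ⟨τ, G, h⟩ := hS
  have key : ∀ a : Id, A.soloExcess r a v =
      ∫ o, excess r v (o 0).2 ∂G 1 fun _ => v := by
    intro a
    have hlaw : A.outcomeLaw {a} (fun _ => v) = (G 1 fun _ => v).map fun o _ => o 0 := by
      rw [(h {a} fun _ => v).2]
      convert sum_smul_map_of_card_eq_one (Finset.card_singleton a) (τ {a} fun _ => v) G v
    have hm : Measurable fun (o : Fin 1 → Outcome) (_ : ({a} : Finset Id)) => o 0 :=
      measurable_pi_lambda _ fun i => measurable_pi_apply _
    have h2 : Measurable fun o : ({a} : Finset Id) → Outcome =>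
        excess r v ((o default).2 : ℝ) :=
      (measurable_excess _ _).comp (measurable_pi_apply default).snd.coe_nnreal_real
    rw [hA.soloExcess_eq, hlaw, integral_map hm.aemeasurable h2.aestronglyMeasurable]
  rw [key a, key a']

/-! ### Resampling the platform's coins against a single buyer -/

/-- For `I = {a}` the simulated message is overwritten, so the alternative is just a second run of
the platform on the same message with independent coins. -/
theorem IsAuction.gap_singleton (hA : A.IsAuction k) (hU : U ⊆ Set.Icc 0 1) (a : Id)
    (b : ({a} : Finset Id) → U) :
    A.gap {a} b default =
      resampleGain A.buyerLaw (A.platformLaw {a}) (A.soloPaid a (b default)) := by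
  have hsolo : ∀ z, A.soloPaid a (b default) z ∈ Set.Icc (0 : ℝ) 1 := fun z =>
    hA.paid_mem_Icc hU _ _ _ _
  have hm := measurable_soloPaid (A := A) a (b default)
  have hin := resample_mem_Icc (fun z => (hsolo z).1) (fun z => (hsolo z).2)
  have hover : ∀ y z, A.overpay {a} b default y z =
      max (A.soloPaid a (b default) (z.1, y.2) - A.soloPaid a (b default) z) 0 := by
    intro y z
    have : A.simReply {a} (A.messages b y.1) y.2 default (A.message a (b default) z.1) =
        A.soloReply a (A.message a (b default) z.1) y.2 := by
      unfold simReply soloReply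
      rw [show Function.update (A.messages b y.1) default (A.message a (b default) z.1) =
        fun _ => A.message a (b default) z.1 from
        funext fun i => by rw [Unique.eq_default i, Function.update_self]]
      rfl
    show max (A.paid a (b default) z.1 (A.simReply {a} (A.messages b y.1) y.2 default
      (A.message a (b default) z.1)) - _) 0 = _
    rw [this]; rfl
  unfold gap resampleGain
  simp only [hover]
  have hF : Measurable fun w : A.PlatformCoin {a} × (A.BuyerCoin × A.PlatformCoin {a}) =>
      max (A.soloPaid a (b default) (w.2.1, w.1) - A.soloPaid a (b default) w.2) 0 := by
    fun_prop
  have hH : Measurable fun c' : A.PlatformCoin {a} =>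
      ∫ z, max (A.soloPaid a (b default) (z.1, c') - A.soloPaid a (b default) z) 0
        ∂A.buyerLaw.prod (A.platformLaw {a}) :=
    hF.stronglyMeasurable.integral_prod_right.measurable
  have hstep : ∀ c', ∫ z, max (A.soloPaid a (b default) (z.1, c') - A.soloPaid a (b default) z) 0
        ∂A.buyerLaw.prod (A.platformLaw {a}) =
      ∫ ω, ∫ c, max (A.soloPaid a (b default) (ω, c') - A.soloPaid a (b default) (ω, c)) 0
        ∂A.platformLaw {a} ∂A.buyerLaw := fun c' =>
    integral_prod _ (integrable_of_bounds (hF.comp measurable_prodMk_left) 0 1 fun z => hin _ _)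
  have hsnd := measurePreserving_snd (μ := A.coinsLaw {a}) (ν := A.platformLaw {a})
  refine (hsnd.integral_comp_measurable hH).symm.trans ?_
  simp only [hstep]
  refine (integral_integral_swap ?_).symm
  exact integrable_of_bounds (measurable_integral_resample hm) 0 1
    fun y => integral_mem_Icc fun c => hin _ _

end

end Protocol

namespace Protocol

variable {Id : Type} {U : Set ℝ} {A : Protocol Id U}

/-! ### A single strategic buyer -/

/-- The utility of a buyer with value `v` that is sent the decision and outcome `d`. -/
noncomputable def payoff (v : ℝ) (d : Bool × Outcome) : ℝ :=
  if d.1 = true ∧ 0 < d.2.1 then v - d.2.2 else 0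

/-- The expected utility of a buyer with value `v` that is alone and sends the message `m` under the
identity `a`. -/
noncomputable def messageUtility (A : Protocol Id U) (a : Id) (v : ℝ) (m : A.Msg) : ℝ :=
  ∫ c, payoff v (A.soloReply a m c) ∂A.platformLaw {a}

/-- The number of items that the honest buyer `a` obtains when it is alone. -/
noncomputable def soloGot (A : Protocol Id U) (a : Id) (v : U)
    (z : A.BuyerCoin × A.PlatformCoin {a}) : ℝ :=
  A.got a v z.1 (A.soloReply a (A.message a v z.1) z.2)

/-- The expected utility of the honest buyer `a` when it is alone. -/
noncomputable def honestUtility (A : Protocol Id U) (a : Id) (v : U) : ℝ :=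
  ∫ z, ((v : ℝ) * A.soloGot a v z - A.soloPaid a v z) ∂A.buyerLaw.prod (A.platformLaw {a})

/-- A reserve price: the loss of a buyer with value one that sends a best message. -/
noncomputable def reserve (A : Protocol Id U) (a : Id) : ℝ := 1 - ⨆ m, A.messageUtility a 1 m

theorem measurable_payoff (v : ℝ) : Measurable (payoff v) := by
  have h1 : MeasurableSet {d : Bool × Outcome | d.1 = true} :=
    measurable_fst (measurableSet_singleton true)
  have h2 : MeasurableSet {d : Bool × Outcome | 0 < d.2.1} :=
    measurableSet_lt measurable_const measurable_snd.fst
  exact Measurable.ite (h1.inter h2) (measurable_const.sub measurable_snd.snd.coe_nnreal_real)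
    measurable_const

theorem payoff_le {v : ℝ} (hv : 0 ≤ v) (d : Bool × Outcome) : payoff v d ≤ v := by
  unfold payoff
  split_ifs
  · linarith [d.2.2.2]
  · exact hv

theorem payoff_one_sub {v : ℝ} (hv : v ≤ 1) (d : Bool × Outcome) :
    payoff 1 d - payoff v d ∈ Set.Icc 0 (1 - v) := by
  unfold payoff
  split_ifs <;> constructor <;> linarith

/-- Payments demanded in reply to a dishonest message may be unbounded, so the integrand need not be
integrable; the integral is then `0` by convention. -/
theorem messageUtility_one_le (a : Id) (m : A.Msg) : A.messageUtility a 1 m ≤ 1 := by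
  unfold messageUtility
  by_cases h : Integrable (fun c => payoff 1 (A.soloReply a m c)) (A.platformLaw {a})
  · simpa using integral_mono h (integrable_const (1 : ℝ)) fun c => payoff_le zero_le_one _
  · rw [integral_undef h]; exact zero_le_one

/-- The two payoffs differ by at most `1 - v` pointwise. Since the difference is bounded, they are
integrable together or not at all, and in the latter case both integrals are `0`. -/
theorem messageUtility_one_le_add {v : ℝ} (hv : v ≤ 1) (a : Id) (m : A.Msg) :
    A.messageUtility a 1 m ≤ A.messageUtility a v m + (1 - v) := by
  unfold messageUtility
  have hs := (measurable_soloReply (A := A) a).comp (measurable_prodMk_left (x := m))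
  have hd : Integrable (fun c => payoff 1 (A.soloReply a m c) - payoff v (A.soloReply a m c))
      (A.platformLaw {a}) :=
    integrable_of_bounds (((measurable_payoff 1).comp hs).sub ((measurable_payoff v).comp hs)) 0
      (1 - v) fun c => payoff_one_sub hv _
  by_cases h : Integrable (fun c => payoff v (A.soloReply a m c)) (A.platformLaw {a})
  · have h1 : Integrable (fun c => payoff 1 (A.soloReply a m c)) (A.platformLaw {a}) :=
      (hd.add h).congr (ae_of_all _ fun c => by simp)
    have := integral_mono hd (integrable_const (1 - v)) fun c => (payoff_one_sub hv _).2
    rw [integral_sub h1 h] at this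
    simp at this
    linarith
  · have h1 : ¬ Integrable (fun c => payoff 1 (A.soloReply a m c)) (A.platformLaw {a}) :=
      fun h1 => h ((h1.sub hd).congr (ae_of_all _ fun c => by simp))
    rw [integral_undef h, integral_undef h1]
    linarith

theorem messageUtility_one_le_reserve (a : Id) (m : A.Msg) :
    A.messageUtility a 1 m ≤ 1 - A.reserve a := by
  have : BddAbove (Set.range (A.messageUtility a 1)) :=
    ⟨1, by rintro _ ⟨m, rfl⟩; exact messageUtility_one_le a m⟩
  simpa [reserve] using le_ciSup this m

theorem one_sub_reserve_le [Nonempty A.Msg] (a : Id) {v u : ℝ} (hv : v ≤ 1)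
    (h : ∀ m, A.messageUtility a v m ≤ u) : 1 - A.reserve a ≤ u + (1 - v) := by
  have : (⨆ m, A.messageUtility a 1 m) ≤ u + (1 - v) :=
    ciSup_le fun m => (messageUtility_one_le_add hv a m).trans (by linarith [h m])
  simpa [reserve] using this

theorem reserve_nonneg (a : Id) : 0 ≤ A.reserve a := by
  have : (⨆ m, A.messageUtility a 1 m) ≤ 1 :=
    Real.iSup_le (fun m => messageUtility_one_le a m) zero_le_one
  simpa [reserve] using this

theorem measurable_soloGot (a : Id) (v : U) : Measurable (A.soloGot a v) := by
  have h : Measurable fun z : A.BuyerCoin × A.PlatformCoin {a} => (A.message a v z.1, z.2) :=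
    ((A.measurable_message a v).comp measurable_fst).prodMk measurable_snd
  exact (measurable_got a v).comp (measurable_fst.prodMk ((measurable_soloReply a).comp h))

variable [DecidableEq Id] {k : ℕ}

/-- A strategy using only the identity `a` and a message that is sampled from `law`. -/
def singleBuyer (A : Protocol Id U) (a : Id) {C : Type} [MeasurableSpace C] (law : Measure C)
    [IsProbabilityMeasure law] (f : C → A.Msg) (hf : Measurable f) : A.BuyerStrategy where
  ids := {a}
  Coin := C
  law := law
  send := fun c _ => f c
  measurable_send := measurable_pi_lambda _ fun _ => hf

theorem buyerUtility_singleBuyer (a : Id) {C : Type} [MeasurableSpace C] (law : Measure C)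
    [IsProbabilityMeasure law] (f : C → A.Msg) (hf : Measurable f) (b : (∅ : Finset Id) → U)
    (v : U) : A.buyerUtility (A.singleBuyer a law f hf) ∅ b v =
      ∫ ω, payoff v (A.soloReply a (f ω.2) ω.1) ∂(A.platformLaw {a}).prod law := by
  -- The platform's coin space depends on the participant set, so `∅ ∪ {a}` is replaced by a
  -- variable before being identified with `{a}`.
  have gen : ∀ (K : Finset Id) (hK : K = {a}) (hJ : {a} ⊆ K),
      ∫ ω, buyerPayoff (v : ℝ) {a} hJ (A.platform K (fun _ => f ω.2) ω.1.2)
        ∂((A.coinsLaw ∅).prod (A.platformLaw K)).prod law =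
      ∫ ω, payoff v (A.soloReply a (f ω.2) ω.1) ∂(A.platformLaw {a}).prod law := by
    rintro K rfl hJ
    have hmp := (measurePreserving_snd (μ := A.coinsLaw ∅) (ν := A.platformLaw {a})).prod
      (MeasurePreserving.id law)
    have hm : Measurable fun ω : A.PlatformCoin {a} × C =>
        payoff (v : ℝ) (A.soloReply a (f ω.2) ω.1) :=
      (measurable_payoff v).comp ((measurable_soloReply a).comp
        ((hf.comp measurable_snd).prodMk measurable_fst))
    rw [hmp.integral_comp_measurable hm]
    refine integral_congr_ae (ae_of_all _ fun ω => ?_)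
    unfold buyerPayoff payoff
    simp only [Fintype.sum_unique]
    rfl
  have := gen (∅ ∪ {a}) (Finset.empty_union _) Finset.subset_union_right
  refine Eq.trans ?_ this
  unfold buyerUtility
  refine integral_congr_ae (ae_of_all _ fun ω => ?_)
  have hmix : A.mixedMessages b ω.1.1 ((A.singleBuyer a law f hf).send ω.2) = fun _ => f ω.2 := by
    funext i
    unfold mixedMessages
    rw [dif_neg (Finset.notMem_empty _)]
    rfl
  simp only [hmix]
  rfl

theorem buyerUtility_const (a : Id) {C : Type} [MeasurableSpace C] (law : Measure C)
    [IsProbabilityMeasure law] (m : A.Msg) (b : (∅ : Finset Id) → U) (v : U) :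
    A.buyerUtility (A.singleBuyer a law (fun _ => m) measurable_const) ∅ b v =
      A.messageUtility a v m := by
  rw [buyerUtility_singleBuyer]
  exact (integral_fun_fst (fun c => payoff v (A.soloReply a m c))).trans (by simp [messageUtility])

/-- An accepting buyer has at most one item and pays zero without an item, so the payoff is linear
in the outcome. The true value `w` is decoupled from the value `v` behind the acceptance: `w = v`
serves buyer compatibility and `w = 1` the definition of the reserve. -/
theorem IsAuction.payoff_eq (hA : A.IsAuction k) (a : Id) (v : U) (w : ℝ) (ω : A.BuyerCoin)
    {d : Bool × Outcome} (h : d.1 = true ∧ A.accept a v ω d.2) :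
    payoff w d = w * A.got a v ω d - A.paid a v ω d := by
  obtain ⟨h1, h2⟩ := hA.individually_rational a v ω d.2 h.2
  have hg : A.got a v ω d = (d.2.1 : ℝ) := if_pos h
  have hp : A.paid a v ω d = (d.2.2 : ℝ) := if_pos h
  unfold payoff
  rw [hg, hp]
  rcases Nat.le_one_iff_eq_zero_or_eq_one.1 h1 with h0 | h0
  · rw [h0] at h2 ⊢
    have : (d.2.2 : ℝ) = 0 := le_antisymm (by simpa using h2) d.2.2.2
    simp [this]
  · rw [h0]; simp [h.1]

theorem IsAuction.buyerUtility_honest (hA : A.IsAuction k) (a : Id) (b : (∅ : Finset Id) → U)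
    (v : U) : A.buyerUtility (A.honestBuyer a v) ∅ b v = A.honestUtility a v := by
  refine (buyerUtility_singleBuyer a A.buyerLaw (A.message a v) (A.measurable_message a v) b
    v).trans ?_
  unfold honestUtility
  rw [← integral_prod_swap]
  refine integral_congr_ae ?_
  filter_upwards [hA.ae_soloReply a v] with z hz
  exact hA.payoff_eq a v v z.1 hz

section Single

variable (hA : A.IsAuction k) (hU : U ⊆ Set.Icc 0 1) (a : Id) (v : U)

include hA

theorem IsAuction.ae_messageUtility (w : ℝ) : ∀ᵐ ω ∂A.buyerLaw,
    ∫ c, (w * A.soloGot a v (ω, c) - A.soloPaid a v (ω, c)) ∂A.platformLaw {a} =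
      A.messageUtility a w (A.message a v ω) := by
  filter_upwards [Measure.ae_ae_of_ae_prod (hA.ae_soloReply a v)] with ω hω
  refine integral_congr_ae ?_
  filter_upwards [hω] with c hc
  exact (hA.payoff_eq a v w ω hc).symm

include hU

theorem IsAuction.integral_soloPaid_sub_reserve_le {ε : ℝ}
    (hB : ∀ m, A.messageUtility a v m ≤ A.honestUtility a v + ε) :
    ∫ z, max (A.soloPaid a v z - A.reserve a) 0 ∂A.buyerLaw.prod (A.platformLaw {a}) ≤
      ε + A.gap {a} (fun _ => v) default := by
  have hv := hU v.2
  rw [hA.gap_singleton hU]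
  have : Nonempty A.BuyerCoin := nonempty_of_isProbabilityMeasure A.buyerLaw
  have : Nonempty A.Msg := ⟨A.message a v (Classical.arbitrary _)⟩
  refine integral_excess_le (X := A.soloGot a v) (v := v) (measurable_soloGot a v)
    (measurable_soloPaid a v) (fun z => hA.got_eq _ _ _ _) (fun z => paid_nonneg _ _ _ _)
    (fun z => hA.paid_le_mul_got _ _ _ _) hv.1 hv.2 ?_ ?_
  · exact one_sub_reserve_le a hv.2 hB
  · filter_upwards [hA.ae_messageUtility a v v] with ω hω
    rw [hω]
    exact hB _

theorem IsAuction.reserve_sub_mul_integral_soloPaid_le :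
    (A.reserve a - v) * ∫ z, A.soloPaid a v z ∂A.buyerLaw.prod (A.platformLaw {a}) ≤
      A.gap {a} (fun _ => v) default := by
  have hv := hU v.2
  rw [hA.gap_singleton hU]
  refine mul_integral_payment_le (X := A.soloGot a v) (v := v) (measurable_soloGot a v)
    (measurable_soloPaid a v) (fun z => hA.got_eq _ _ _ _) (fun z => paid_nonneg _ _ _ _)
    (fun z => hA.paid_le_mul_got _ _ _ _) hv.1 hv.2 ?_
  filter_upwards [hA.ae_messageUtility a v 1] with ω hω
  simp only [one_mul] at hω
  rw [hω]
  exact messageUtility_one_le_reserve a _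

/-- Lowering the reserve by `η` costs `η` for buyers above it, and ensures that a buyer below it has
value at distance more than `η` from `reserve`, so that `reserve_sub_mul_integral_soloPaid_le` can
be divided by `η`. -/
theorem IsAuction.soloExcess_reserve_sub_le {ε η : ℝ} (hε : 0 ≤ ε) (hη : 0 < η)
    (hB : ∀ m, A.messageUtility a v m ≤ A.honestUtility a v + ε) :
    A.soloExcess (max (A.reserve a - η) 0) a v ≤
      ε + η + (1 + 1 / η) * A.gap {a} (fun _ => v) default := by
  have hg := gap_nonneg (A := A) {a} (fun _ => v) default
  have hv := hU v.2
  have hg' : 0 ≤ 1 / η * A.gap {a} (fun _ => v) default := by positivity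
  have hsolo : ∀ z, A.soloPaid a v z ∈ Set.Icc (0 : ℝ) 1 := fun z => hA.paid_mem_Icc hU _ _ _ _
  unfold soloExcess excess
  by_cases h : (v : ℝ) < max (A.reserve a - η) 0
  · simp only [h, if_true]
    -- The truncation at `0` is harmless because values are nonnegative.
    have h1 : η < A.reserve a - v := by
      rcases lt_max_iff.1 h with h | h <;> linarith [hv.1]
    have h2 := hA.reserve_sub_mul_integral_soloPaid_le hU a v
    have h3 : 0 ≤ ∫ z, A.soloPaid a v z ∂A.buyerLaw.prod (A.platformLaw {a}) :=
      integral_nonneg fun z => (hsolo z).1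
    have h4 : ∫ z, A.soloPaid a v z ∂A.buyerLaw.prod (A.platformLaw {a}) ≤
        1 / η * A.gap {a} (fun _ => v) default := by
      rw [one_div, ← div_eq_inv_mul, le_div_iff₀ hη]
      nlinarith
    linarith
  · simp only [h, if_false]
    have h2 := hA.integral_soloPaid_sub_reserve_le hU a v hB
    have hm := measurable_soloPaid (A := A) a v
    have hi : ∀ r : ℝ, 0 ≤ r → Integrable (fun z => max (A.soloPaid a v z - r) 0)
        (A.buyerLaw.prod (A.platformLaw {a})) := fun r hr =>
      integrable_of_bounds (by fun_prop) 0 1 fun z =>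
        ⟨le_max_right _ _, max_le (by linarith [(hsolo z).2]) zero_le_one⟩
    have h3 : ∫ z, max (A.soloPaid a v z - max (A.reserve a - η) 0) 0
          ∂A.buyerLaw.prod (A.platformLaw {a}) ≤
        ∫ z, (max (A.soloPaid a v z - A.reserve a) 0 + η)
          ∂A.buyerLaw.prod (A.platformLaw {a}) := by
      refine integral_mono (hi _ (le_max_right _ _))
        ((hi _ (reserve_nonneg a)).add (integrable_const _)) fun z => ?_
      refine max_le ?_ (add_nonneg (le_max_right _ _) hη.le)
      linarith [le_max_left (A.soloPaid a v z - A.reserve a) 0, le_max_left (A.reserve a - η) 0]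
    rw [integral_add (hi _ (reserve_nonneg a)) (integrable_const _)] at h3
    simp at h3
    linarith

/-- With zero gap nothing is divided, so the reserve need not be lowered: for `v` below it, a
positive mean payment would make a product of positive factors nonpositive. -/
theorem IsAuction.soloExcess_reserve_le_zero
    (hB : ∀ m, A.messageUtility a v m ≤ A.honestUtility a v)
    (hg : A.gap {a} (fun _ => v) default ≤ 0) : A.soloExcess (A.reserve a) a v ≤ 0 := by
  unfold soloExcess excess
  by_cases h : (v : ℝ) < A.reserve a
  · simp only [h, if_true]
    have h2 := hA.reserve_sub_mul_integral_soloPaid_le hU a v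
    by_contra! h3
    nlinarith [mul_pos (sub_pos.2 h) h3]
  · simp only [h, if_false]
    have := hA.integral_soloPaid_sub_reserve_le hU a v (ε := 0) (by simpa using hB)
    linarith

end Single

end Protocol

/-! ### Ex post and averaged bounds on the gaps. -/

namespace Protocol

theorem integral_pi_singleton {Id : Type} {U : Set ℝ} [Finite U] (D : PMF U) (a : Id) (f : U → ℝ) :
    ∫ b : ({a} : Finset Id) → U, f (b default) ∂(Measure.pi fun _ => D.toMeasure) =
      ∫ v, f v ∂D.toMeasure :=
  (measurePreserving_const_of_unique (ι := ({a} : Finset Id)) D.toMeasure).integral_comp_measurable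
    (measurable_of_countable fun b : ({a} : Finset Id) → U => f (b default))

variable {Id : Type} [DecidableEq Id] {U : Set ℝ} {A : Protocol Id U} {k : ℕ}

theorem IsAuction.gap_le (hA : A.IsAuction k) (hU : U ⊆ Set.Icc 0 1) (I : Finset Id)
    (b : I → U) (i : I) {ε : ℝ} (h : ∀ m c, A.simAdvantage I m c i (b i) ≤ ε) :
    A.gap I b i ≤ ε := by
  have := hA.sum_mul_gap_le hU I b i {b i} 1 (ε := ε) (by simpa using h)
  simpa using this

section Finite

variable [Finite U] (D : PMF U)

theorem IsAuction.integral_gap_update_le (hA : A.IsAuction k) (hU : U ⊆ Set.Icc 0 1)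
    (I : Finset Id) (b : I → U) (i : I) {ε : ℝ}
    (h : ∀ m c, ∫ v, A.simAdvantage I m c i v ∂D.toMeasure ≤ ε) :
    ∫ v, A.gap I (Function.update b i v) i ∂D.toMeasure ≤ ε := by
  have := Fintype.ofFinite U
  simp only [PMF.integral_eq_sum, smul_eq_mul] at h ⊢
  exact hA.sum_mul_gap_le hU I b i Finset.univ (fun v => (D v).toReal) h

/-- Redrawing the value of `i` preserves the product law, so one may fix the other values and
average over that of `i` alone, as the Bayesian game against the single buyer `i` does. -/
theorem IsAuction.integral_gap_le (hA : A.IsAuction k) (hU : U ⊆ Set.Icc 0 1)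
    (I : Finset Id) (i : I) {ε : ℝ}
    (h : ∀ m c, ∫ v, A.simAdvantage I m c i v ∂D.toMeasure ≤ ε) :
    ∫ b, A.gap I b i ∂(Measure.pi fun _ : I => D.toMeasure) ≤ ε := by
  have hmp := measurePreserving_update D.toMeasure i
  have hint : Integrable (fun z : (I → U) × U => A.gap I (Function.update z.1 i z.2) i)
      ((Measure.pi fun _ : I => D.toMeasure).prod D.toMeasure) := .of_finite
  rw [hmp.integral_comp_measurable (measurable_of_countable _), integral_prod _ hint]
  have := integral_mono hint.integral_prod_left
    (integrable_const (μ := Measure.pi fun _ : I => D.toMeasure) ε)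
    fun b => hA.integral_gap_update_le D hU I b i h
  simpa using this

theorem IsAuction.integral_gap_singleton_le (hA : A.IsAuction k) (hU : U ⊆ Set.Icc 0 1) (a : Id)
    {ε : ℝ} (h : ∀ m c, ∫ v, A.simAdvantage {a} m c default v ∂D.toMeasure ≤ ε) :
    ∫ v, A.gap {a} (fun _ => v) default ∂D.toMeasure ≤ ε := by
  have h1 := hA.integral_gap_le D hU {a} default h
  have hmp := measurePreserving_const_of_unique (ι := ({a} : Finset Id)) D.toMeasure
  rwa [hmp.integral_comp_measurable (measurable_of_countable _)] at h1

end Finite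

/-! ### Bounds from information-theoretic incentive compatibility -/

theorem IsAuction.messageUtility_le (hA : A.IsAuction k) (hB : A.BuyerIC) (a : Id) (v : U)
    (m : A.Msg) : A.messageUtility a v m ≤ A.honestUtility a v := by
  -- The message is constant, so the coin law is a dummy; no other buyer is present.
  have := hB (A.singleBuyer a A.buyerLaw (fun _ => m) measurable_const) ∅ (fun _ => v) a v
    (Finset.notMem_empty a) (Finset.disjoint_empty_left _)
  rwa [buyerUtility_const, hA.buyerUtility_honest] at this

theorem IsAuction.bayes_messageUtility_le (hA : A.IsAuction k) {D : PMF U} (hB : A.BayesBuyerIC D)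
    (a : Id) (v : U) (m : A.Msg) : A.messageUtility a v m ≤ A.honestUtility a v := by
  have := hB (A.singleBuyer a A.buyerLaw (fun _ => m) measurable_const) ∅ a v
    (Finset.notMem_empty a) (Finset.disjoint_empty_left _)
  simpa only [buyerUtility_const, hA.buyerUtility_honest, integral_const, probReal_univ,
    one_smul] using this

theorem IsAuction.simDeviation_feasible (hA : A.IsAuction k) (I : Finset Id) (m : I → A.Msg)
    (c : A.PlatformCoin I) (i : I) :
    (A.deviation (A.simReply I m c i) (measurable_simReply I m c i)).Feasible k :=
  hA.deviation_feasible _ _ fun x => hA.simReply_le I m c i x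

theorem IsAuction.simAdvantage_le_zero (hA : A.IsAuction k) (hP : A.PlatformSellerIC k)
    (I : Finset Id) (m : I → A.Msg) (c : A.PlatformCoin I) (i : I) (v : U) :
    A.simAdvantage I m c i v ≤ 0 := by
  have := hP _ (hA.simDeviation_feasible I m c i) {i.1} fun _ => v
  rw [coalitionUtility_deviation, coalitionUtility_honest] at this
  exact sub_nonpos.2 this

theorem IsAuction.integral_simAdvantage_le_zero (hA : A.IsAuction k) [Finite U] {D : PMF U}
    (hP : A.BayesPlatformSellerIC k D) (I : Finset Id) (m : I → A.Msg) (c : A.PlatformCoin I)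
    (i : I) : ∫ v, A.simAdvantage I m c i v ∂D.toMeasure ≤ 0 := by
  have := hP _ (hA.simDeviation_feasible I m c i) {i.1}
  simp only [coalitionUtility_deviation, coalitionUtility_honest] at this
  rw [integral_pi_singleton D i.1 fun v => A.soloUtility i.1 v _,
    integral_pi_singleton D i.1 fun v => A.soloUtility i.1 v _] at this
  unfold simAdvantage
  rw [integral_sub .of_finite .of_finite]
  exact sub_nonpos.2 this

theorem soloExcess_nonneg {r : ℝ} (hr : 0 ≤ r) (hA : A.IsAuction k) (hU : U ⊆ Set.Icc 0 1) (a : Id)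
    (v : U) : 0 ≤ A.soloExcess r a v :=
  integral_nonneg fun _ => (excess_mem_Icc hr (hA.paid_mem_Icc hU _ _ _ _)).1

theorem exists_reserve (hA : A.IsAuction k) (hS : A.WeaklySymmetric) (hU : U ⊆ Set.Icc 0 1)
    (hB : A.BuyerIC) (hP : A.PlatformSellerIC k) :
    ∃ r : ℝ≥0, ∀ (I : Finset Id) (b : I → U), A.revenue I b ≤ postedRevenue k r b := by
  -- Without identities there is none from which to define the reserve, but then there are no buyers
  -- either.
  rcases isEmpty_or_nonempty Id with hId | ⟨⟨a⟩⟩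
  · refine ⟨0, fun I b => (hA.revenue_le hU 0 I b).trans_eq ?_⟩
    have : IsEmpty I := ⟨fun i => hId.elim i⟩
    simp
  · refine ⟨⟨A.reserve a, reserve_nonneg a⟩, fun I b => (hA.revenue_le hU ⟨A.reserve a, reserve_nonneg a⟩ I b).trans ?_⟩
    have : ∑ i, (A.gap I b i + A.soloExcess (A.reserve a) i (b i)) ≤ 0 := by
      refine Finset.sum_nonpos fun i _ => add_nonpos ?_ ?_
      · exact hA.gap_le hU I b i fun m c => hA.simAdvantage_le_zero hP I m c i _
      · rw [hS.soloExcess_congr hA _ i.1 a]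
        exact hA.soloExcess_reserve_le_zero hU a (b i) (hA.messageUtility_le hB a _)
          (hA.gap_le hU _ _ _ fun m c => hA.simAdvantage_le_zero hP _ m c _ _)
    exact add_le_of_nonpos_right this

/-- The gaps are nonnegative with nonpositive mean, hence vanish almost surely; on that event the ex
post argument applies. Buyer compatibility is needed for every value and remains pointwise, since
with no other buyers there is nothing to average. -/
theorem exists_reserve_bayes [Finite U] (hA : A.IsAuction k) (hS : A.WeaklySymmetric)
    (hU : U ⊆ Set.Icc 0 1) (D : PMF U) (hB : A.BayesBuyerIC D) (hP : A.BayesPlatformSellerIC k D) :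
    ∃ r : ℝ≥0, ∀ I : Finset Id, ∀ᵐ b ∂(Measure.pi fun _ : I => D.toMeasure),
      A.revenue I b ≤ postedRevenue k r b := by
  rcases isEmpty_or_nonempty Id with hId | ⟨⟨a⟩⟩
  · refine ⟨0, fun I => ae_of_all _ fun b => (hA.revenue_le hU 0 I b).trans_eq ?_⟩
    have : IsEmpty I := ⟨fun i => hId.elim i⟩
    simp
  · refine ⟨⟨A.reserve a, reserve_nonneg a⟩, fun I => ?_⟩
    have h1 : ∀ᵐ b ∂(Measure.pi fun _ : I => D.toMeasure), ∀ i : I, A.gap I b i = 0 := by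
      refine ae_all_iff.2 fun i => ?_
      have h := hA.integral_gap_le D hU I i fun m c => hA.integral_simAdvantage_le_zero hP I m c i
      exact (integral_eq_zero_iff_of_nonneg (fun b => gap_nonneg I b i) .of_finite).1
        (le_antisymm h (integral_nonneg fun b => gap_nonneg I b i))
    have h2 : ∀ᵐ v ∂D.toMeasure, A.gap {a} (fun _ => v) default = 0 := by
      have h := hA.integral_gap_singleton_le D hU a fun m c =>
        hA.integral_simAdvantage_le_zero hP {a} m c default
      exact (integral_eq_zero_iff_of_nonneg (fun v => gap_nonneg {a} _ _) .of_finite).1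
        (le_antisymm h (integral_nonneg fun v => gap_nonneg {a} _ _))
    have h3 : ∀ᵐ b ∂(Measure.pi fun _ : I => D.toMeasure), ∀ i : I,
        A.gap {a} (fun _ => b i) default = 0 := ae_all_iff.2 fun i =>
      (measurePreserving_eval (fun _ : I => D.toMeasure) i).quasiMeasurePreserving.ae h2
    filter_upwards [h1, h3] with b hb1 hb3
    refine (hA.revenue_le hU ⟨A.reserve a, reserve_nonneg a⟩ I b).trans ?_
    have : ∑ i, (A.gap I b i + A.soloExcess (A.reserve a) i (b i)) ≤ 0 := by
      refine Finset.sum_nonpos fun i _ => add_nonpos (hb1 i).le ?_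
      rw [hS.soloExcess_congr hA _ i.1 a]
      exact hA.soloExcess_reserve_le_zero hU a (b i) (hA.bayes_messageUtility_le hB a _)
        (hb3 i).le
    exact add_le_of_nonpos_right this

/-! ### Quantitative bounds -/

theorem IsAuction.revenue_le_of_gap_le (hA : A.IsAuction k) (hS : A.WeaklySymmetric)
    (hU : U ⊆ Set.Icc 0 1) (a : Id) {ε₀ ε₁ ε₂ η : ℝ} (h0 : 0 ≤ ε₀) (hη : 0 < η)
    (hB : ∀ (v : U) m, A.messageUtility a v m ≤ A.honestUtility a v + ε₀)
    (h1 : ∀ v, A.gap {a} (fun _ => v) default ≤ ε₁) (I : Finset Id) (b : I → U)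
    (h2 : ∀ i, A.gap I b i ≤ ε₂) :
    A.revenue I b ≤ postedRevenue k (A.reserve a - η).toNNReal b +
      I.card * (ε₂ + (ε₀ + η + (1 + 1 / η) * ε₁)) := by
  refine (hA.revenue_le hU (A.reserve a - η).toNNReal I b).trans ?_
  gcongr
  rw [← Fintype.card_coe, ← Finset.card_univ, ← nsmul_eq_mul]
  refine Finset.sum_le_card_nsmul _ _ _ fun i _ => add_le_add (h2 i) ?_
  rw [hS.soloExcess_congr hA _ i.1 a, Real.coe_toNNReal']
  refine (hA.soloExcess_reserve_sub_le hU a (b i) h0 hη (hB _)).trans ?_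
  gcongr
  exact h1 _

/-- Markov's inequality for the total error `F`, whose mean is bounded term by term. -/
theorem IsAuction.measureReal_revenue_gt_le [Finite U] (hA : A.IsAuction k)
    (hS : A.WeaklySymmetric) (hU : U ⊆ Set.Icc 0 1) (D : PMF U) (a : Id) {ε₀ ε₁ ε₂ η s : ℝ}
    (h0 : 0 ≤ ε₀) (hη : 0 < η)
    (hB : ∀ (v : U) m, A.messageUtility a v m ≤ A.honestUtility a v + ε₀)
    (h1 : ∫ v, A.gap {a} (fun _ => v) default ∂D.toMeasure ≤ ε₁) (I : Finset Id)
    (h2 : ∀ i, ∫ b, A.gap I b i ∂(Measure.pi fun _ : I => D.toMeasure) ≤ ε₂) :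
    s * (Measure.pi fun _ : I => D.toMeasure).real
        {b | postedRevenue k (A.reserve a - η).toNNReal b + s < A.revenue I b} ≤
      I.card * (ε₂ + (ε₀ + η + (1 + 1 / η) * ε₁)) := by
  set r := (A.reserve a - η).toNNReal with hr
  set F : (I → U) → ℝ := fun b => ∑ i, (A.gap I b i + A.soloExcess r i (b i)) with hF
  have hF0 : ∀ b, 0 ≤ F b := fun b => Finset.sum_nonneg fun i _ =>
    add_nonneg (gap_nonneg I b i) (soloExcess_nonneg r.2 hA hU _ _)
  have hsolo : ∀ i : I, ∫ b, A.soloExcess r i (b i) ∂(Measure.pi fun _ : I => D.toMeasure) ≤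
      ε₀ + η + (1 + 1 / η) * ε₁ := by
    intro i
    rw [← (measurePreserving_eval (fun _ : I => D.toMeasure) i).integral_comp_measurable
      (measurable_of_countable fun v => A.soloExcess r i v)]
    calc _ ≤ ∫ v, (ε₀ + η + (1 + 1 / η) * A.gap {a} (fun _ => v) default) ∂D.toMeasure := by
          refine integral_mono .of_finite .of_finite fun v => ?_
          show A.soloExcess r i.1 v ≤ _
          rw [hS.soloExcess_congr hA _ i.1 a, hr, Real.coe_toNNReal']
          exact hA.soloExcess_reserve_sub_le hU a v h0 hη (hB _)
      _ = ε₀ + η + (1 + 1 / η) * ∫ v, A.gap {a} (fun _ => v) default ∂D.toMeasure := by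
          rw [integral_add .of_finite .of_finite, integral_const_mul]
          simp
      _ ≤ _ := by gcongr
  have hint : ∫ b, F b ∂(Measure.pi fun _ : I => D.toMeasure) ≤
      I.card * (ε₂ + (ε₀ + η + (1 + 1 / η) * ε₁)) := by
    rw [integral_finsetSum _ fun i _ => .of_finite, ← Fintype.card_coe, ← Finset.card_univ,
      ← nsmul_eq_mul]
    refine Finset.sum_le_card_nsmul _ _ _ fun i _ => ?_
    rw [integral_add .of_finite .of_finite]
    exact add_le_add (h2 i) (hsolo i)
  by_cases hs : 0 ≤ s
  · refine le_trans ?_ ((mul_meas_ge_le_integral_of_nonneg (ae_of_all _ hF0) .of_finite s).trans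
      hint)
    refine mul_le_mul_of_nonneg_left (measureReal_mono fun b hb => ?_) hs
    have := hA.revenue_le hU r I b
    have hb' : postedRevenue k r b + s < A.revenue I b := hb
    show s ≤ F b
    linarith
  · refine le_trans ?_ ((integral_nonneg hF0).trans hint)
    exact mul_nonpos_of_nonpos_of_nonneg (not_le.1 hs).le measureReal_nonneg

end Protocol

/-! ### Building circuits -/

namespace Circuit

/-- Renaming the input wires. -/
def rename {o : Type} : {ι ι' : Type} → Circuit o ι → (ι → ι') → Circuit o ι'
  | _, _, ret out, g => ret fun k => g (out k)
  | _, _, const c rest, g => const c (rest.rename (Option.map g))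
  | _, _, gate f i j rest, g => gate f (g i) (g j) (rest.rename (Option.map g))

theorem eval_rename {o ι ι' : Type} (C : Circuit o ι) (g : ι → ι') (x : ι' → Bool) :
    (C.rename g).eval x = C.eval fun i => x (g i) := by
  induction C generalizing ι' with
  | ret out => rfl
  | const c rest ih =>
    simp only [rename, eval, ih]
    congr 1
    funext w
    cases w <;> rfl
  | gate f i j rest ih =>
    simp only [rename, eval, ih]
    congr 1
    funext w
    cases w <;> rfl

theorem size_rename {o ι ι' : Type} (C : Circuit o ι) (g : ι → ι') :
    (C.rename g).size = C.size := by
  induction C generalizing ι' with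
  | ret out => rfl
  | const c rest ih => simp only [rename, size, ih]
  | gate f i j rest ih => simp only [rename, size, ih]

/-- Feeding the outputs of a circuit, together with its inputs, into another circuit. -/
def andThen {o o' : Type} : {ι : Type} → Circuit o ι → Circuit o' (ι ⊕ o) → Circuit o' ι
  | _, ret out, K => K.rename (Sum.elim id out)
  | _, const c rest, K => const c (rest.andThen (K.rename (Sum.map some id)))
  | _, gate f i j rest, K => gate f i j (rest.andThen (K.rename (Sum.map some id)))

theorem eval_andThen {o o' ι : Type} (C : Circuit o ι) (K : Circuit o' (ι ⊕ o)) (x : ι → Bool) :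
    (C.andThen K).eval x = K.eval (Sum.elim x (C.eval x)) := by
  induction C with
  | ret out =>
    simp only [andThen, eval_rename, eval]
    congr 1
    funext w
    cases w <;> rfl
  | const c rest ih =>
    simp only [andThen, eval, ih, eval_rename]
    congr 1
    funext w
    cases w <;> rfl
  | gate f i j rest ih =>
    simp only [andThen, eval, ih, eval_rename]
    congr 1
    funext w
    cases w <;> rfl

theorem size_andThen {o o' ι : Type} (C : Circuit o ι) (K : Circuit o' (ι ⊕ o)) :
    (C.andThen K).size = C.size + K.size := by
  induction C with
  | ret out => simp only [andThen, size, size_rename, zero_add]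
  | const c rest ih => simp only [andThen, size, ih, size_rename]; omega
  | gate f i j rest ih => simp only [andThen, size, ih, size_rename]; omega

end Circuit

/-- The function `f` is computed by a circuit with at most `s` gates. -/
def HasCircuit {ι o : Type} (f : (ι → Bool) → o → Bool) (s : ℕ) : Prop :=
  ∃ C : Circuit o ι, C.size ≤ s ∧ ∀ x, C.eval x = f x

namespace HasCircuit

variable {ι ι' o o' : Type} {f : (ι → Bool) → o → Bool} {s t : ℕ}

theorem mono (h : HasCircuit f s) (hst : s ≤ t) : HasCircuit f t :=
  let ⟨C, hC, e⟩ := h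
  ⟨C, hC.trans hst, e⟩

theorem of_circuit (C : Circuit o ι) : HasCircuit C.eval C.size := ⟨C, le_rfl, fun _ => rfl⟩

theorem select (g : o → ι) : HasCircuit (fun (x : ι → Bool) k => x (g k)) 0 :=
  ⟨.ret g, le_rfl, fun _ => rfl⟩

theorem gate (f : Bool → Bool → Bool) (i j : ι) :
    HasCircuit (fun (x : ι → Bool) (_ : Unit) => f (x i) (x j)) 1 :=
  ⟨.gate f i j (.ret fun _ => none), le_rfl, fun _ => rfl⟩

theorem precomp (h : HasCircuit f s) (g : ι → ι') :
    HasCircuit (fun (x : ι' → Bool) => f fun i => x (g i)) s :=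
  let ⟨C, hC, e⟩ := h
  ⟨C.rename g, (C.size_rename g).trans_le hC, fun x => (C.eval_rename g x).trans (e _)⟩

theorem andThen (h : HasCircuit f s) {g : (ι ⊕ o → Bool) → o' → Bool} (h' : HasCircuit g t) :
    HasCircuit (fun x => g (Sum.elim x (f x))) (s + t) :=
  let ⟨C, hC, e⟩ := h
  let ⟨K, hK, e'⟩ := h'
  ⟨C.andThen K, (C.size_andThen K).trans_le (add_le_add hC hK), fun x => by
    rw [C.eval_andThen, e', e]⟩

theorem comp (h : HasCircuit f s) {g : (o → Bool) → o' → Bool} (h' : HasCircuit g t) :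
    HasCircuit (fun x => g (f x)) (s + t) :=
  h.andThen (h'.precomp Sum.inr)

theorem postcomp (h : HasCircuit f s) (g : o' → o) : HasCircuit (fun x k => f x (g k)) s :=
  h.comp (select g)

theorem pair (h : HasCircuit f s) {g : (ι → Bool) → o' → Bool} (h' : HasCircuit g t) :
    HasCircuit (fun x => Sum.elim (f x) (g x)) (s + t) := by
  have := h.andThen ((h'.precomp Sum.inl).andThen
    (select (Sum.elim (fun k => Sum.inl (Sum.inr k)) Sum.inr : o ⊕ o' → (ι ⊕ o) ⊕ o')))
  refine this.mono le_rfl |>.imp fun C hC => ⟨hC.1, fun x => (hC.2 x).trans ?_⟩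
  funext k
  cases k <;> rfl

theorem const (c : Bool) : HasCircuit (fun (_ : ι → Bool) (_ : o) => c) 1 :=
  ⟨.const c (.ret fun _ => none), le_rfl, fun _ => rfl⟩

/-- Replacing input wires by other wires or by constants. -/
theorem subst (h : HasCircuit f s) (g : ι → ι' ⊕ Bool) :
    HasCircuit (fun (x : ι' → Bool) => f fun i => Sum.elim x id (g i)) (s + 2) := by
  have h2 : HasCircuit (fun (x : ι' → Bool) => Sum.elim (fun _ : Unit => true)
      (Sum.elim (fun _ : Unit => false) x)) 2 :=
    (const true).pair ((const false).pair (select id))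
  have := h2.comp (h.precomp fun i => Sum.elim (fun w => Sum.inr (Sum.inr w))
    (fun c => if c then Sum.inl () else Sum.inr (Sum.inl ())) (g i))
  rw [add_comm]
  refine this.imp fun C hC => ⟨hC.1, fun x => (hC.2 x).trans ?_⟩
  refine congrArg f (funext fun i => ?_)
  rcases g i with w | (_ | _) <;> rfl

theorem hardwired (y : o → Bool) : HasCircuit (fun (_ : ι → Bool) => y) 2 :=
  (subst (select id) fun k => (Sum.inr (y k) : ι ⊕ Bool)).mono le_rfl

theorem ofFn {n : ℕ} {f : (ι → Bool) → Fin n → Bool}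
    (h : ∀ k, HasCircuit (fun x (_ : Unit) => f x k) s) : HasCircuit f (n * s) := by
  induction n with
  | zero => exact ⟨.ret fun k => k.elim0, by simp [Circuit.size], fun x => funext fun k => k.elim0⟩
  | succ n ih =>
    have := ((ih fun k => h k.castSucc).pair (h (Fin.last n))).postcomp
      (Fin.lastCases (Sum.inr ()) Sum.inl : Fin (n + 1) → Fin n ⊕ Unit)
    refine (this.mono (by rw [Nat.succ_mul])).imp fun C hC => ⟨hC.1, fun x => (hC.2 x).trans ?_⟩
    funext k
    refine Fin.lastCases ?_ (fun k => ?_) k <;> simp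

theorem pi [Fintype o] (h : ∀ k, HasCircuit (fun x (_ : Unit) => f x k) s) :
    HasCircuit f (Fintype.card o * s) := by
  have e := Fintype.equivFin o
  have := (ofFn (f := fun x k => f x (e.symm k)) fun k => h (e.symm k)).postcomp e
  simpa using this

theorem mux (i j l : ι) :
    HasCircuit (fun (x : ι → Bool) (_ : Unit) => if x i then x j else x l) 3 := by
  have h := ((gate (fun a b => a && b) i j).pair (gate (fun a b => !a && b) i l)).comp
    (gate (fun a b => a || b) (Sum.inl ()) (Sum.inr ()))
  refine h.imp fun C hC => ⟨hC.1, fun x => (hC.2 x).trans ?_⟩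
  funext _
  cases h : x i <;> simp [h]

end HasCircuit

/-! ### Negligible functions -/

namespace Negligible

variable {ε δ : ℕ → ℝ}

theorem add (h : Negligible ε) (h' : Negligible δ) : Negligible fun n => ε n + δ n := by
  refine ⟨fun n => add_nonneg (h.1 n) (h'.1 n), fun p hp => ?_⟩
  have hp2 : ∀ n : ℕ, 0 < (Polynomial.C 2 * p).eval (n : ℝ) := fun n => by
    simpa using hp n
  filter_upwards [h.2 _ hp2, h'.2 _ hp2] with n h1 h2
  have hpn := hp n
  simp only [Polynomial.eval_mul, Polynomial.eval_C] at h1 h2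
  have : 1 / p.eval (n : ℝ) = 1 / (2 * p.eval (n : ℝ)) + 1 / (2 * p.eval (n : ℝ)) := by
    field_simp; norm_num
  linarith

/-- Testing against `p * (N + 1)` rather than `p * N` keeps the test polynomial positive. -/
theorem polynomial_mul (h : Negligible ε) (N : Polynomial ℕ) :
    Negligible fun n => ((N.eval n : ℕ) : ℝ) * ε n := by
  refine ⟨fun n => mul_nonneg (Nat.cast_nonneg _) (h.1 n), fun p hp => ?_⟩
  have hN : ∀ n : ℕ, (N.map (Nat.castRingHom ℝ)).eval (n : ℝ) = ((N.eval n : ℕ) : ℝ) := fun n => by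
    simp
  have hp2 : ∀ n : ℕ, 0 < (p * (N.map (Nat.castRingHom ℝ) + 1)).eval (n : ℝ) := fun n => by
    rw [Polynomial.eval_mul, Polynomial.eval_add, hN, Polynomial.eval_one]
    exact mul_pos (hp n) (by positivity)
  filter_upwards [h.2 _ hp2] with n h1
  have hpn := hp n
  rw [Polynomial.eval_mul, Polynomial.eval_add, hN, Polynomial.eval_one] at h1
  rw [lt_div_iff₀ (by positivity)] at h1 ⊢
  nlinarith [mul_nonneg (h.1 n) hpn.le]

theorem sqrt (h : Negligible ε) : Negligible fun n => √(ε n) := by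
  refine ⟨fun n => Real.sqrt_nonneg _, fun p hp => ?_⟩
  have hp2 : ∀ n : ℕ, 0 < (p ^ 2).eval (n : ℝ) := fun n => by
    rw [Polynomial.eval_pow]; exact pow_pos (hp n) 2
  filter_upwards [h.2 _ hp2] with n h1
  rw [Real.sqrt_lt' (one_div_pos.2 (hp n)), div_pow, one_pow]
  simpa using h1

theorem exp_neg : Negligible fun n => Real.exp (-(n : ℝ)) := by
  refine ⟨fun n => (Real.exp_pos _).le, fun p hp => ?_⟩
  have h := (Polynomial.tendsto_div_exp_atTop p).comp (tendsto_natCast_atTop_atTop (R := ℝ))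
  filter_upwards [h.eventually (gt_mem_nhds zero_lt_one)] with n hn
  have hn' : p.eval (n : ℝ) / Real.exp n < 1 := hn
  rw [div_lt_one (Real.exp_pos _)] at hn'
  rw [Real.exp_neg, ← one_div]
  exact one_div_lt_one_div_of_lt (hp n) hn'

/-- A bound against each family of attacks gives a bound against all attacks. -/
theorem exists_uniform {T V : ℕ → Type} [∀ κ, Nonempty (T κ)] (adv : ∀ κ, T κ → V κ → ℝ)
    (hadv : ∀ κ t v, adv κ t v ≤ 1)
    (h : ∀ s : ∀ κ, T κ, ∃ ε, Negligible ε ∧ ∀ κ v, adv κ (s κ) v ≤ ε κ) :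
    ∃ ε, Negligible ε ∧ ∀ κ t v, adv κ t v ≤ ε κ := by
  -- For each `κ` pick one attack that attains more than half of the best advantage. These choices
  -- form a single family, whose negligible bound, doubled, controls all attacks.
  have key : ∀ κ, ∃ t₀ : T κ, ∀ e : ℝ, 0 ≤ e → (∀ v, adv κ t₀ v ≤ e) →
      ∀ t v, adv κ t v ≤ e + e := by
    intro κ
    by_cases hpos : ∀ t v, adv κ t v ≤ 0
    · exact ⟨Classical.arbitrary _, fun e he _ t v => (hpos t v).trans (by linarith)⟩
    · push Not at hpos
      obtain ⟨t₁, v₁, h₁⟩ := hpos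
      set A : Set ℝ := Set.range fun p : T κ × V κ => adv κ p.1 p.2
      have hA : BddAbove A := ⟨1, by rintro _ ⟨p, rfl⟩; exact hadv κ p.1 p.2⟩
      have hA0 : 0 < sSup A := h₁.trans_le (le_csSup hA ⟨(t₁, v₁), rfl⟩)
      obtain ⟨_, ⟨⟨t₀, v₀⟩, rfl⟩, h₀⟩ := exists_lt_of_lt_csSup (s := A) ⟨_, (t₁, v₁), rfl⟩
        (half_lt_self hA0)
      refine ⟨t₀, fun e _ he t v => ?_⟩
      have h1 : adv κ t v ≤ sSup A := le_csSup hA ⟨(t, v), rfl⟩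
      have h2 := he v₀
      simp only at h₀
      linarith
  choose s hs using key
  obtain ⟨ε, hε, hle⟩ := h s
  exact ⟨_, hε.add hε, fun κ t v => hs κ (ε κ) (hε.1 κ) (hle κ) t v⟩

end Negligible

theorem Polynomial.eval_nat_mono (q : Polynomial ℕ) {x y : ℕ} (h : x ≤ y) : q.eval x ≤ q.eval y := by
  rw [Polynomial.eval_eq_sum, Polynomial.eval_eq_sum]
  exact Finset.sum_le_sum fun n _ => Nat.mul_le_mul_left _ (Nat.pow_le_pow_left h n)

namespace EfficientProtocol

variable {U : ℕ → Set ℝ} (P : EfficientProtocol U) {k : ℕ → ℕ}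

theorem finite_values {U : ℕ → Set ℝ} (P : EfficientProtocol U) (κ : ℕ) : Finite (U κ) := Finite.of_injective _ (P.encode_injective κ)

/-! ### Sending a fixed message -/

/-- The message is non-uniform advice, hardwired with two constant gates and no coins. -/
theorem exists_constAttack (a : ∀ κ, P.Id κ) (m : ∀ κ, Bits (P.msgLen κ)) :
    ∃ S : P.BuyerAttack, ∀ κ, S.ids κ = {a κ} ∧ ∀ b v,
      (P.protocol κ).buyerUtility (S.strategy κ) ∅ b v =
        (P.protocol κ).messageUtility (a κ) v (m κ) := by
  have hC : ∀ κ, HasCircuit (fun (_ : Fin 0 → Bool)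
      (w : ({a κ} : Finset (P.Id κ)) × Fin (P.msgLen κ)) => m κ w.2) 2 := fun κ =>
    HasCircuit.hardwired _
  choose C hCs hCe using hC
  refine ⟨⟨fun κ => {a κ}, fun _ => 0, C, 2, fun κ => ⟨?_, Nat.zero_le _, ?_⟩⟩, fun κ =>
    ⟨rfl, fun b v => ?_⟩⟩
  · simp
  · simpa using hCs κ
  · rw [← Protocol.buyerUtility_const (A := P.protocol κ) (a κ) (uniformBits 0) (m κ) b v]
    congr 1
    unfold BuyerAttack.strategy Protocol.singleBuyer
    congr 1
    funext c i t
    exact congrFun (hCe κ c) (i, t)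

/-! ### Choosing the better of two executions -/

section Circuits

variable {P} {κ : ℕ}

/-- The better of the outputs for one buyer of an alternative execution `y` and of the honest
execution `x`, given a circuit that compares payments. -/
def betterBits {l : ℕ} (C : Circuit Unit (Fin l ⊕ Fin l)) (y x : Option (Fin l) → Bool) :
    Option (Fin l) → Bool :=
  if (y none && !C.eval (Sum.elim (fun t => y (some t)) fun t => x (some t)) ()) = true then y else x

theorem hasCircuit_betterBits {l : ℕ} (C : Circuit Unit (Fin l ⊕ Fin l)) :
    HasCircuit (fun w : Option (Fin l) ⊕ Option (Fin l) → Bool =>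
      betterBits C (fun t => w (Sum.inl t)) fun t => w (Sum.inr t)) (C.size + 1 + (l + 1) * 3) := by
  have h1 : HasCircuit (fun w : Option (Fin l) ⊕ Option (Fin l) → Bool =>
      C.eval (Sum.elim (fun t => w (Sum.inl (some t))) fun t => w (Sum.inr (some t)))) C.size := by
    refine ((HasCircuit.of_circuit C).precomp (Sum.map some some)).imp fun K hK => ⟨hK.1, fun w => (hK.2 w).trans ?_⟩
    refine congrArg C.eval (funext fun i => ?_)
    cases i <;> rfl
  have h2 := h1.andThen (HasCircuit.gate (fun c d => c && !d) (Sum.inl (Sum.inl none))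
    (Sum.inr ()))
  have h3 := h2.andThen (HasCircuit.pi (s := 3) (f := fun z (t : Option (Fin l)) =>
    if z (Sum.inr ()) then z (Sum.inl (Sum.inl t)) else z (Sum.inl (Sum.inr t)))
    fun t => HasCircuit.mux _ _ _)
  refine (h3.mono (by simp)).imp fun K hK => ⟨hK.1, fun w => (hK.2 w).trans ?_⟩
  funext t
  simp only [betterBits, Sum.elim_inr, Sum.elim_inl]
  split_ifs with h
  · exact if_pos h
  · exact if_neg h

/-- The wires of the honest platform run by a coalition that knows all inputs but the message of
the buyer `i`, which is the message of its honest buyer `j`. -/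
def simWires {I : Finset (P.Id κ)} (m : I → Bits (P.msgLen κ))
    (c : Bits (P.platformCoinLen κ I.card)) (i : I) {n l : ℕ} (j : Fin n) :
    (Fin I.card × (Fin (P.idLen κ) ⊕ Fin (P.msgLen κ))) ⊕ Fin (P.platformCoinLen κ I.card) →
      ((Fin n × (Fin (P.idLen κ) ⊕ Fin (P.msgLen κ))) ⊕ Fin l) ⊕ Bool :=
  Sum.elim
    (fun z => Sum.elim (fun t : Fin (P.idLen κ) => Sum.inr ((I.orderIsoOfFin rfl z.1).1.1.testBit t))
      (fun t => if I.orderIsoOfFin rfl z.1 = i then Sum.inl (Sum.inl (j, Sum.inr t))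
        else Sum.inr (m (I.orderIsoOfFin rfl z.1) t)) z.2)
    fun t => Sum.inr (c t)

theorem elim_simWires {I : Finset (P.Id κ)} (m : I → Bits (P.msgLen κ))
    (c : Bits (P.platformCoinLen κ I.card)) (i : I) {n l : ℕ} (j : Fin n)
    (x : (Fin n × (Fin (P.idLen κ) ⊕ Fin (P.msgLen κ))) ⊕ Fin l → Bool) :
    (fun w => Sum.elim x id (simWires m c i j w)) =
      P.inputBits I (Function.update m i fun t => x (Sum.inl (j, Sum.inr t))) c := by
  funext w
  rcases w with ⟨z, t | t⟩ | t
  · rfl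
  · simp only [simWires, inputBits, Sum.elim_inl, Sum.elim_inr]
    by_cases h : I.orderIsoOfFin rfl z = i
    · rw [if_pos h, h, Function.update_self]; rfl
    · rw [if_neg h, Function.update_of_ne h]; rfl
  · rfl

/-- The output for the buyer `i` in an execution of the honest platform. -/
def outputBits (I : Finset (P.Id κ)) (m : I → Bits (P.msgLen κ))
    (c : Bits (P.platformCoinLen κ I.card)) (i : I) : Option (Fin (P.outLen κ)) → Bool :=
  fun t => (P.platform κ I.card).eval (P.inputBits I m c)
    (t.map fun t => ((I.orderIsoOfFin rfl).symm i, t))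

/-- The decision and outcome represented by output bits. -/
noncomputable def decodeReply (y : Option (Fin (P.outLen κ)) → Bool) : Bool × Outcome :=
  (y none, P.decode κ fun t => y (some t))

/-- The comparison circuit decides the weak order with the alternative first; its negation is the
strict inequality that `Protocol.better` tests. -/
theorem decodeReply_betterBits {C : Circuit Unit (Fin (P.outLen κ) ⊕ Fin (P.outLen κ))}
    (hC : ∀ x y : Bits (P.outLen κ),
      C.eval (Sum.elim x y) () = true ↔ (P.decode κ x).2 ≤ (P.decode κ y).2)
    (y x : Option (Fin (P.outLen κ)) → Bool) :
    decodeReply (betterBits C y x) = Protocol.better (decodeReply (P := P) y) (decodeReply x) := by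
  have h : (y none && !C.eval (Sum.elim (fun t => y (some t)) fun t => x (some t)) ()) = true ↔
      y none = true ∧ (P.decode κ fun t => x (some t)).2 < (P.decode κ fun t => y (some t)).2 := by
    rw [Bool.and_eq_true, Bool.not_eq_true', ← Bool.not_eq_true, hC, not_le]
  unfold betterBits
  split_ifs with h'
  · exact (if_pos (h.1 h')).symm
  · exact (if_neg fun h'' => h' (h.2 h'')).symm

/-- Two copies of the platform circuit are run, one on the real inputs and one with everything but
the target's message hardwired; a comparison and a row of multiplexers then select the output. -/
theorem hasCircuit_simAttack (C : Circuit Unit (Fin (P.outLen κ) ⊕ Fin (P.outLen κ)))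
    {I : Finset (P.Id κ)} (m : I → Bits (P.msgLen κ)) (c : Bits (P.platformCoinLen κ I.card))
    (i : I) (n : ℕ) :
    HasCircuit (fun (x : (Fin n × (Fin (P.idLen κ) ⊕ Fin (P.msgLen κ))) ⊕
          Fin (P.platformCoinLen κ n) → Bool) (w : Fin n × Option (Fin (P.outLen κ))) =>
        if n = 1 then betterBits C
          (outputBits I (Function.update m i fun t => x (Sum.inl (w.1, Sum.inr t))) c i)
          (fun t => (P.platform κ n).eval x (t.map fun t => (w.1, t))) w.2 else false)
      ((P.platform κ n).size + (P.platform κ I.card).size + C.size + 3 * P.outLen κ + 7) := by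
  by_cases hn : n = 1
  · subst hn
    have h1 := ((HasCircuit.of_circuit (P.platform κ I.card)).subst
      (simWires (l := P.platformCoinLen κ 1) m c i (0 : Fin 1))).postcomp
      (fun t : Option (Fin (P.outLen κ)) => t.map fun t => ((I.orderIsoOfFin rfl).symm i, t))
    have h2 := (HasCircuit.of_circuit (P.platform κ 1)).postcomp
      (fun t : Option (Fin (P.outLen κ)) => t.map fun t => ((0 : Fin 1), t))
    have h3 := ((h1.pair h2).comp (hasCircuit_betterBits C)).postcomp
      (Prod.snd : Fin 1 × Option (Fin (P.outLen κ)) → _)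
    refine (h3.mono (by omega)).imp fun K hK => ⟨hK.1, fun x => (hK.2 x).trans ?_⟩
    funext w
    obtain ⟨j, t⟩ := w
    rw [Subsingleton.elim j 0]
    simp only [elim_simWires, Sum.elim_inl, Sum.elim_inr, if_true]
    rfl
  · simp only [hn, if_false]
    exact (HasCircuit.const false).mono (by omega)

end Circuits

theorem exists_simAttack (hP : P.IsAuction k) (N : Polynomial ℕ) (I : ∀ κ, Finset (P.Id κ))
    (hN : ∀ κ, (I κ).card ≤ N.eval κ) (m : ∀ κ, I κ → Bits (P.msgLen κ))
    (c : ∀ κ, Bits (P.platformCoinLen κ (I κ).card)) (i : ∀ κ, I κ) :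
    ∃ S : P.PlatformAttack, ∀ κ, (S.strategy κ).Feasible (k κ) ∧
      ∀ (a : P.Id κ) (b : ({a} : Finset (P.Id κ)) → U κ),
        (P.protocol κ).coalitionUtility (S.strategy κ) {a} b =
          (P.protocol κ).soloUtility a (b default) fun x c' => Protocol.better
            ((P.protocol κ).simReply (I κ) (m κ) (c κ) (i κ) x)
            ((P.protocol κ).soloReply a x c') := by
  obtain ⟨q, hq⟩ := P.polynomial
  choose _ _ _ hout _ _ hplat C hC hCe using hq
  choose K hKs hKe using fun κ n => hasCircuit_simAttack (C κ) (m κ) (c κ) (i κ) n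
  have hpoly : ∃ Q : Polynomial ℕ, ∀ κ n,
      P.platformCoinLen κ n ≤ Q.eval (κ + n) ∧ (K κ n).size ≤ Q.eval (κ + n) := by
    -- The composed term pays for the simulated platform with up to `N` participants; `4 * q` covers
    -- the comparison circuit and three gates per output bit.
    refine ⟨q + q.comp (Polynomial.X + N) + 4 * q + 7, fun κ n => ?_⟩
    have e : (q + q.comp (Polynomial.X + N) + 4 * q + 7).eval (κ + n) =
        q.eval (κ + n) + q.eval (κ + n + N.eval (κ + n)) + 4 * q.eval (κ + n) + 7 := by
      simp
    have h1 : q.eval κ ≤ q.eval (κ + n) := q.eval_nat_mono (by omega)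
    have h2 : q.eval (κ + (I κ).card) ≤ q.eval (κ + n + N.eval (κ + n)) := by
      have := N.eval_nat_mono (Nat.le_add_right κ n)
      have := hN κ
      exact q.eval_nat_mono (by omega)
    have h3 := hplat κ n
    have h4 := (hplat κ (I κ).card).2
    have h5 := hKs κ n
    have h6 := hC κ
    have h7 := hout κ
    rw [e]
    constructor <;> omega
  let S : P.PlatformAttack := ⟨P.platformCoinLen, K, hpoly⟩
  have hact : ∀ κ (J : Finset (P.Id κ)) (μ : J → Bits (P.msgLen κ))
      (r : Bits (P.platformCoinLen κ J.card)) (j : J), J.card = 1 →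
      (S.strategy κ).act J μ r j = Protocol.better
        ((P.protocol κ).simReply (I κ) (m κ) (c κ) (i κ) (μ j)) ((P.protocol κ).reply J μ r j) := by
    intro κ J μ r j hJ
    have h1 : (S.strategy κ).act J μ r j = decodeReply fun t =>
        (K κ J.card).eval (P.inputBits J μ r) ((J.orderIsoOfFin rfl).symm j, t) := rfl
    rw [h1]
    show _ = Protocol.better
      (decodeReply (outputBits (I κ) (Function.update (m κ) (i κ) (μ j)) (c κ) (i κ)))
      (decodeReply (outputBits J μ r j))
    rw [← decodeReply_betterBits (hCe κ)]
    congr 1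
    funext t
    rw [hKe]
    refine (if_pos hJ).trans ?_
    have h2 : (fun t => P.inputBits J μ r (Sum.inl ((J.orderIsoOfFin rfl).symm j, Sum.inr t))) =
        μ j := by
      funext t
      simp [inputBits]
    simp only [h2]
    rfl
  have hact' : ∀ κ (J : Finset (P.Id κ)) (μ : J → Bits (P.msgLen κ))
      (r : Bits (P.platformCoinLen κ J.card)) (j : J), J.card ≠ 1 →
      ((S.strategy κ).act J μ r j).1 = false := by
    intro κ J μ r j hJ
    have h1 : ((S.strategy κ).act J μ r j).1 =
        (K κ J.card).eval (P.inputBits J μ r) ((J.orderIsoOfFin rfl).symm j, none) := rfl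
    rw [h1, hKe]
    exact if_neg hJ
  refine ⟨S, fun κ => ⟨fun J μ r => ?_, fun a b => ?_⟩⟩
  · by_cases hJ : J.card = 1
    · refine le_trans (le_of_eq ?_) ((hP κ).1.simDeviation_feasible (I κ) (m κ) (c κ) (i κ) J μ r)
      refine Finset.sum_congr rfl fun j _ => ?_
      rw [hact κ J μ r j hJ]
      simp only [Protocol.deviation, if_pos hJ]
    · simp [hact' κ J μ r _ hJ]
  · refine (Protocol.integral_singleton (A := P.protocol κ) ((S.strategy κ).law {a}) a b
      ((S.strategy κ).act {a}) ((S.strategy κ).measurable_act {a})).trans ?_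
    unfold Protocol.soloUtility
    refine integral_congr_ae (ae_of_all _ fun z => ?_)
    exact congrArg ((P.protocol κ).paid a (b default) z.1)
      (hact κ {a} (fun _ => (P.protocol κ).message a (b default) z.1) z.2 default
        (Finset.card_singleton a))

end EfficientProtocol

/-! ### A priori bounds on advantages, as required for uniformity. -/

namespace Protocol

variable {Id : Type} [DecidableEq Id] {U : Set ℝ} {A : Protocol Id U} {k : ℕ}

theorem IsAuction.soloUtility_mem_Icc (hA : A.IsAuction k) (hU : U ⊆ Set.Icc 0 1) (a : Id) (v : U)
    (act : A.Msg → A.PlatformCoin {a} → Bool × Outcome) :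
    A.soloUtility a v act ∈ Set.Icc (0 : ℝ) 1 :=
  integral_mem_Icc fun z => hA.paid_mem_Icc hU a v z.1 (act (A.message a v z.1) z.2)

theorem IsAuction.simAdvantage_le_one (hA : A.IsAuction k) (hU : U ⊆ Set.Icc 0 1) (I : Finset Id)
    (m : I → A.Msg) (c : A.PlatformCoin I) (i : I) (v : U) : A.simAdvantage I m c i v ≤ 1 := by
  have h1 := (hA.soloUtility_mem_Icc hU i.1 v
    fun x c' => better (A.simReply I m c i x) (A.soloReply i.1 x c')).2
  have h2 := (hA.soloUtility_mem_Icc hU i.1 v fun x c' => A.soloReply i.1 x c').1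
  unfold simAdvantage
  linarith

theorem IsAuction.messageUtility_sub_le_one (hA : A.IsAuction k) (hU : U ⊆ Set.Icc 0 1) (a : Id)
    (m : A.Msg) (v : U) : A.messageUtility a v m - A.honestUtility a v ≤ 1 := by
  have hv := hU v.2
  have h1 : A.messageUtility a v m ≤ 1 := by
    unfold messageUtility
    by_cases h : Integrable (fun c => payoff v (A.soloReply a m c)) (A.platformLaw {a})
    · have := integral_mono h (integrable_const (v : ℝ)) fun c => payoff_le hv.1 _
      simp at this
      linarith [hv.2]
    · rw [integral_undef h]; exact zero_le_one
  have h2 : 0 ≤ A.honestUtility a v := integral_nonneg fun z =>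
    sub_nonneg.2 (hA.paid_le_mul_got a v z.1 _)
  linarith

end Protocol

/-! ### Uniform negligible bounds and the computational theorems. -/

namespace EfficientProtocol

variable {U : ℕ → Set ℝ} {P : EfficientProtocol U} {k : ℕ → ℕ}

/-- The data of a deviation of the coalition that simulates at most `N κ` buyers. -/
structure Simulation (P : EfficientProtocol U) (N : Polynomial ℕ) (κ : ℕ) where
  ids : Finset (P.Id κ)
  card_le : ids.card ≤ N.eval κ
  msg : ids → Bits (P.msgLen κ)
  coin : Bits (P.platformCoinLen κ ids.card)
  target : ids

instance (N : Polynomial ℕ) (κ : ℕ) : Nonempty (P.Simulation (N + 1) κ) :=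
  -- A target must exist, so at least one buyer has to be allowed; hence `N + 1`.
  ⟨{0}, by simp, fun _ _ => false, fun _ => false, ⟨0, Finset.mem_singleton_self _⟩⟩

/-- Only attacks with one identity and no other buyers are needed, which makes the ex post and the
Bayesian notion coincide. -/
theorem exists_buyer_bound (hU : ∀ κ, U κ ⊆ Set.Icc 0 1) (hP : P.IsAuction k)
    (h : ∀ S : P.BuyerAttack, ∃ ε : ℕ → ℝ, Negligible ε ∧ ∀ κ (a : P.Id κ) (v : U κ),
      S.ids κ = {a} → (P.protocol κ).buyerUtility (S.strategy κ) ∅ (fun _ => v) v ≤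
        (P.protocol κ).honestUtility a v + ε κ) :
    ∃ ε : ℕ → ℝ, Negligible ε ∧ ∀ κ (a : P.Id κ) (v : U κ) m,
      (P.protocol κ).messageUtility a v m ≤ (P.protocol κ).honestUtility a v + ε κ := by
  obtain ⟨ε, hε, hle⟩ := Negligible.exists_uniform (T := fun κ => P.Id κ × Bits (P.msgLen κ))
    (V := fun κ => U κ) (fun κ t v => (P.protocol κ).messageUtility t.1 v t.2 -
      (P.protocol κ).honestUtility t.1 v)
    (fun κ t v => (hP κ).1.messageUtility_sub_le_one (hU κ) t.1 t.2 v) fun s => by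
      obtain ⟨S, hS⟩ := P.exists_constAttack (fun κ => (s κ).1) fun κ => (s κ).2
      obtain ⟨ε, hε, hle⟩ := h S
      refine ⟨ε, hε, fun κ v => ?_⟩
      have := hle κ _ v (hS κ).1
      rw [(hS κ).2] at this
      linarith
  exact ⟨ε, hε, fun κ a v m => by linarith [hle κ (a, m) v]⟩

theorem CompBuyerIC.exists_bound (h : P.CompBuyerIC) (hU : ∀ κ, U κ ⊆ Set.Icc 0 1)
    (hP : P.IsAuction k) : ∃ ε : ℕ → ℝ, Negligible ε ∧ ∀ κ (a : P.Id κ) (v : U κ) m,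
      (P.protocol κ).messageUtility a v m ≤ (P.protocol κ).honestUtility a v + ε κ :=
  exists_buyer_bound hU hP fun S => by
    obtain ⟨ε, hε, hle⟩ := h 0 S
    refine ⟨ε, hε, fun κ a v _ => ?_⟩
    have := hle κ ∅ (by simp) (fun _ => v) a v (Finset.notMem_empty a)
      (Finset.disjoint_empty_left _)
    rwa [(hP κ).1.buyerUtility_honest] at this

theorem CompBayesBuyerIC.exists_bound {D : ∀ κ, PMF (U κ)} (h : P.CompBayesBuyerIC D)
    (hU : ∀ κ, U κ ⊆ Set.Icc 0 1) (hP : P.IsAuction k) :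
    ∃ ε : ℕ → ℝ, Negligible ε ∧ ∀ κ (a : P.Id κ) (v : U κ) m,
      (P.protocol κ).messageUtility a v m ≤ (P.protocol κ).honestUtility a v + ε κ :=
  exists_buyer_bound hU hP fun S => by
    obtain ⟨ε, hε, hle⟩ := h 0 S
    refine ⟨ε, hε, fun κ a v _ => ?_⟩
    have := hle κ ∅ (by simp) a v (Finset.notMem_empty a) (Finset.disjoint_empty_left _)
    have hb : ∀ b : (∅ : Finset (P.Id κ)) → U κ, b = fun _ => v := fun b =>
      funext fun i => absurd i.2 (Finset.notMem_empty _)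
    have hc : ∀ b : (∅ : Finset (P.Id κ)) → U κ,
        (P.protocol κ).buyerUtility (S.strategy κ) ∅ b v =
          (P.protocol κ).buyerUtility (S.strategy κ) ∅ (fun _ => v) v := fun b => by rw [hb b]
    simpa only [hc, (hP κ).1.buyerUtility_honest, integral_const, probReal_univ, one_smul]
      using this

/-- `N` bounds the number of simulated buyers, which affects only the size of the attack. The attack
itself faces one buyer, so compatibility is invoked with the polynomial `1`. -/
theorem CompPlatformSellerIC.exists_bound (h : P.CompPlatformSellerIC k)
    (hU : ∀ κ, U κ ⊆ Set.Icc 0 1) (hP : P.IsAuction k) (N : Polynomial ℕ) :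
    ∃ ε : ℕ → ℝ, Negligible ε ∧ ∀ κ (I : Finset (P.Id κ)), I.card ≤ N.eval κ →
      ∀ (b : I → U κ) (i : I), (P.protocol κ).gap I b i ≤ ε κ := by
  obtain ⟨ε, hε, hle⟩ := Negligible.exists_uniform (T := P.Simulation (N + 1))
    (V := fun κ => U κ)
    (fun κ t v => (P.protocol κ).simAdvantage t.ids t.msg t.coin t.target v)
    (fun κ t v => (hP κ).1.simAdvantage_le_one (hU κ) t.ids t.msg t.coin t.target v) fun s => by
      obtain ⟨S, hS⟩ := P.exists_simAttack hP (N + 1) _ (fun κ => (s κ).card_le)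
        (fun κ => (s κ).msg) (fun κ => (s κ).coin) fun κ => (s κ).target
      obtain ⟨ε, hε, hle⟩ := h 1 S fun κ => (hS κ).1
      refine ⟨ε, hε, fun κ v => ?_⟩
      have := hle κ {(s κ).target.1} (by simp) fun _ => v
      rw [(hS κ).2, Protocol.coalitionUtility_honest] at this
      unfold Protocol.simAdvantage
      linarith
  refine ⟨ε, hε, fun κ I hI b i => (hP κ).1.gap_le (hU κ) I b i fun m c => ?_⟩
  exact hle κ ⟨I, hI.trans (by simp), m, c, i⟩ (b i)

/-- Compatibility holds only on average over the target's value, so the advantage is averaged before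
the worst advice is chosen, and `V` is trivial. -/
theorem CompBayesPlatformSellerIC.exists_bound {D : ∀ κ, PMF (U κ)}
    (h : P.CompBayesPlatformSellerIC k D) (hU : ∀ κ, U κ ⊆ Set.Icc 0 1) (hP : P.IsAuction k)
    (N : Polynomial ℕ) :
    ∃ ε : ℕ → ℝ, Negligible ε ∧ ∀ κ (I : Finset (P.Id κ)), I.card ≤ N.eval κ →
      ∀ (m : I → (P.protocol κ).Msg) c (i : I),
        ∫ v, (P.protocol κ).simAdvantage I m c i v ∂(D κ).toMeasure ≤ ε κ := by
  have hfin := P.finite_values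
  obtain ⟨ε, hε, hle⟩ := Negligible.exists_uniform (T := P.Simulation (N + 1))
    (V := fun _ => Unit)
    (fun κ t _ => ∫ v, (P.protocol κ).simAdvantage t.ids t.msg t.coin t.target v
      ∂(D κ).toMeasure)
    (fun κ t _ => by
      have := integral_mono (μ := (D κ).toMeasure) .of_finite (integrable_const 1) fun v =>
        (hP κ).1.simAdvantage_le_one (hU κ) t.ids t.msg t.coin t.target v
      simpa using this) fun s => by
      obtain ⟨S, hS⟩ := P.exists_simAttack hP (N + 1) _ (fun κ => (s κ).card_le)
        (fun κ => (s κ).msg) (fun κ => (s κ).coin) fun κ => (s κ).target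
      obtain ⟨ε, hε, hle⟩ := h 1 S fun κ => (hS κ).1
      refine ⟨ε, hε, fun κ _ => ?_⟩
      have := hle κ {(s κ).target.1} (by simp)
      simp only [(hS κ).2, Protocol.coalitionUtility_honest] at this
      rw [Protocol.integral_pi_singleton (D κ) (s κ).target.1 fun v =>
          (P.protocol κ).soloUtility (s κ).target.1 v _,
        Protocol.integral_pi_singleton (D κ) (s κ).target.1 fun v =>
          (P.protocol κ).soloUtility (s κ).target.1 v _] at this
      unfold Protocol.simAdvantage
      rw [integral_sub .of_finite .of_finite]
      linarith
  exact ⟨ε, hε, fun κ I hI m c i => hle κ ⟨I, hI.trans (by simp), m, c, i⟩ ()⟩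

theorem one_add_one_div_mul_le {η ε : ℝ} (hη : 0 < η) (h : ε ≤ η ^ 2) :
    (1 + 1 / η) * ε ≤ ε + η := by
  have : 1 / η * ε ≤ η := by
    rw [one_div, ← div_eq_inv_mul, div_le_iff₀ hη]
    linarith [sq η]
  linarith

theorem exists_reserve (hU : ∀ κ, U κ ⊆ Set.Icc 0 1) (hP : P.IsAuction k) (hB : P.CompBuyerIC)
    (hS : P.CompPlatformSellerIC k) :
    ∃ r : ℕ → ℝ≥0, ∀ N : Polynomial ℕ, ∃ ε : ℕ → ℝ, Negligible ε ∧
      ∀ (κ : ℕ) (I : Finset (P.Id κ)), I.card ≤ N.eval κ → ∀ b : I → U κ,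
        (P.protocol κ).revenue I b ≤ postedRevenue (k κ) (r κ) b + ε κ := by
  obtain ⟨ε₀, hε₀, h0⟩ := hB.exists_bound hU hP
  obtain ⟨ε₁, hε₁, h1⟩ := hS.exists_bound hU hP 1
  -- The square root balances `η` against `ε₁ / η`; the exponential keeps `η` positive when `ε₁`
  -- vanishes. Only the one-buyer bound `ε₁` enters, so the reserve is fixed before `N` is given.
  set η : ℕ → ℝ := fun κ => √(ε₁ κ + Real.exp (-(κ : ℝ))) with hη
  have hη1 : ∀ κ, 0 < ε₁ κ + Real.exp (-(κ : ℝ)) := fun κ =>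
    add_pos_of_nonneg_of_pos (hε₁.1 κ) (Real.exp_pos _)
  have hηneg : Negligible η := (hε₁.add Negligible.exp_neg).sqrt
  refine ⟨fun κ => ((P.protocol κ).reserve 0 - η κ).toNNReal, fun N => ?_⟩
  obtain ⟨ε₂, hε₂, h2⟩ := hS.exists_bound hU hP N
  refine ⟨_, (hε₂.add ((hε₀.add hηneg).add (hε₁.add hηneg))).polynomial_mul N,
    fun κ I hI b => ?_⟩
  refine ((hP κ).1.revenue_le_of_gap_le (hP κ).2 (hU κ) 0 (hε₀.1 κ) (Real.sqrt_pos.2 (hη1 κ))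
    (h0 κ 0) (fun v => h1 κ {0} (by simp) (fun _ => v) default) I b
    (h2 κ I hI b)).trans ?_
  have h3 : (1 + 1 / η κ) * ε₁ κ ≤ ε₁ κ + η κ := by
    refine one_add_one_div_mul_le (Real.sqrt_pos.2 (hη1 κ)) ?_
    rw [Real.sq_sqrt (hη1 κ).le]
    linarith [Real.exp_pos (-(κ : ℝ))]
  have h4 : ε₂ κ + (ε₀ κ + η κ + (1 + 1 / η κ) * ε₁ κ) ≤
      ε₂ κ + (ε₀ κ + η κ + (ε₁ κ + η κ)) := by linarith
  have h5 : 0 ≤ ε₂ κ + (ε₀ κ + η κ + (ε₁ κ + η κ)) := by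
    linarith [hε₀.1 κ, hε₁.1 κ, hε₂.1 κ, hηneg.1 κ]
  have h6 : (I.card : ℝ) ≤ ((N.eval κ : ℕ) : ℝ) := Nat.cast_le.2 hI
  have h7 := (mul_le_mul_of_nonneg_left h4 (Nat.cast_nonneg I.card)).trans
    (mul_le_mul_of_nonneg_right h6 h5)
  exact add_le_add_right h7 _

theorem exists_reserve_bayes (hU : ∀ κ, U κ ⊆ Set.Icc 0 1) (hP : P.IsAuction k)
    {D : ∀ κ, PMF (U κ)} (hB : P.CompBayesBuyerIC D) (hS : P.CompBayesPlatformSellerIC k D) :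
    ∃ r : ℕ → ℝ≥0, ∀ N : Polynomial ℕ, ∃ ε : ℕ → ℝ, Negligible ε ∧
      ∀ (κ : ℕ) (I : Finset (P.Id κ)), I.card ≤ N.eval κ →
        (Measure.pi fun _ : I => (D κ).toMeasure).real
          {b | postedRevenue (k κ) (r κ) b + ε κ < (P.protocol κ).revenue I b} ≤ ε κ := by
  have hfin := P.finite_values
  obtain ⟨ε₀, hε₀, h0⟩ := hB.exists_bound hU hP
  obtain ⟨ε₁, hε₁, h1⟩ := hS.exists_bound hU hP 1
  set η : ℕ → ℝ := fun κ => √(ε₁ κ + Real.exp (-(κ : ℝ))) with hη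
  have hη1 : ∀ κ, 0 < ε₁ κ + Real.exp (-(κ : ℝ)) := fun κ =>
    add_pos_of_nonneg_of_pos (hε₁.1 κ) (Real.exp_pos _)
  have hηneg : Negligible η := (hε₁.add Negligible.exp_neg).sqrt
  refine ⟨fun κ => ((P.protocol κ).reserve 0 - η κ).toNNReal, fun N => ?_⟩
  obtain ⟨ε₂, hε₂, h2⟩ := hS.exists_bound hU hP N
  -- The factor `N + 1` makes `δ` positive, so that one may divide by its square root.
  have hδ := (hε₂.add ((hε₀.add hηneg).add (hε₁.add hηneg))).polynomial_mul (N + 1)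
  refine ⟨_, hδ.sqrt, fun κ I hI => ?_⟩
  have h3 : (1 + 1 / η κ) * ε₁ κ ≤ ε₁ κ + η κ := by
    refine one_add_one_div_mul_le (Real.sqrt_pos.2 (hη1 κ)) ?_
    rw [Real.sq_sqrt (hη1 κ).le]
    linarith [Real.exp_pos (-(κ : ℝ))]
  have h4 : ε₂ κ + (ε₀ κ + η κ + (1 + 1 / η κ) * ε₁ κ) ≤
      ε₂ κ + (ε₀ κ + η κ + (ε₁ κ + η κ)) := by linarith
  have h5 : 0 < ε₂ κ + (ε₀ κ + η κ + (ε₁ κ + η κ)) := by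
    linarith [hε₀.1 κ, hε₁.1 κ, hε₂.1 κ, Real.sqrt_pos.2 (hη1 κ)]
  have hN : N.eval κ ≤ (N + 1).eval κ := by simp
  have h6 : (I.card : ℝ) ≤ (((N + 1).eval κ : ℕ) : ℝ) := Nat.cast_le.2 (hI.trans hN)
  have h7 := (mul_le_mul_of_nonneg_left h4 (Nat.cast_nonneg I.card)).trans
    (mul_le_mul_of_nonneg_right h6 h5.le)
  have h8 : (0 : ℝ) < (((N + 1).eval κ : ℕ) : ℝ) := by
    simp only [Polynomial.eval_add, Polynomial.eval_one]
    positivity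
  set δ : ℝ := (((N + 1).eval κ : ℕ) : ℝ) * (ε₂ κ + (ε₀ κ + η κ + (ε₁ κ + η κ))) with hδ'
  have h9 : 0 < δ := mul_pos h8 h5
  -- With threshold `√δ`, Markov's inequality gives probability at most `δ / √δ = √δ`, so the same
  -- function bounds both the revenue error and the failure probability.
  have h10 := ((hP κ).1.measureReal_revenue_gt_le (hP κ).2 (hU κ) (D κ) 0 (s := √δ) (hε₀.1 κ)
    (Real.sqrt_pos.2 (hη1 κ)) (h0 κ 0)
    ((hP κ).1.integral_gap_singleton_le (D κ) (hU κ) 0 fun m c => h1 κ {0} (by simp) m c default)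
    I fun i => (hP κ).1.integral_gap_le (D κ) (hU κ) I i fun m c => h2 κ I hI m c i).trans h7
  refine le_of_mul_le_mul_left (h10.trans_eq ?_) (Real.sqrt_pos.2 h9)
  exact (Real.mul_self_sqrt h9.le).symm

end EfficientProtocol

theorem mainTheorem8 :
    -- computational, ex post
    (∀ (U : ℕ → Set ℝ), (∀ κ, U κ ⊆ Set.Icc 0 1) → ∀ (k : ℕ → ℕ) (P : EfficientProtocol U),
      P.IsAuction k → P.CompBuyerIC → P.CompPlatformSellerIC k →
      ∃ r : ℕ → ℝ≥0, ∀ N : Polynomial ℕ, ∃ ε : ℕ → ℝ, Negligible ε ∧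
        ∀ (κ : ℕ) (I : Finset (P.Id κ)), I.card ≤ N.eval κ → ∀ b : I → U κ,
          (P.protocol κ).revenue I b ≤ postedRevenue (k κ) (r κ) b + ε κ) ∧
    -- information-theoretic, ex post
    (∀ (Id : ℕ → Type) [∀ κ, DecidableEq (Id κ)] (U : ℕ → Set ℝ), (∀ κ, U κ ⊆ Set.Icc 0 1) →
      ∀ (k : ℕ → ℕ) (A : ∀ κ, Protocol (Id κ) (U κ)),
      (∀ κ, (A κ).IsAuction (k κ) ∧ (A κ).WeaklySymmetric) →
      (∀ κ, (A κ).BuyerIC) → (∀ κ, (A κ).PlatformSellerIC (k κ)) →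
      ∃ r : ℕ → ℝ≥0, ∀ (κ : ℕ) (I : Finset (Id κ)) (b : I → U κ),
        (A κ).revenue I b ≤ postedRevenue (k κ) (r κ) b) ∧
    -- computational, Bayesian
    (∀ (U : ℕ → Set ℝ), (∀ κ, U κ ⊆ Set.Icc 0 1) → ∀ (k : ℕ → ℕ) (P : EfficientProtocol U),
      P.IsAuction k → ∀ D : ∀ κ, PMF (U κ), P.Samplable D →
      P.CompBayesBuyerIC D → P.CompBayesPlatformSellerIC k D →
      ∃ r : ℕ → ℝ≥0, ∀ N : Polynomial ℕ, ∃ ε : ℕ → ℝ, Negligible ε ∧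
        ∀ (κ : ℕ) (I : Finset (P.Id κ)), I.card ≤ N.eval κ →
          (Measure.pi fun _ : I => (D κ).toMeasure).real
            {b | postedRevenue (k κ) (r κ) b + ε κ < (P.protocol κ).revenue I b} ≤ ε κ) ∧
    -- information-theoretic, Bayesian
    (∀ (Id : ℕ → Type) [∀ κ, DecidableEq (Id κ)] (U : ℕ → Set ℝ), (∀ κ, U κ ⊆ Set.Icc 0 1) →
      (∀ κ, (U κ).Finite) → ∀ (k : ℕ → ℕ) (A : ∀ κ, Protocol (Id κ) (U κ)),
      (∀ κ, (A κ).IsAuction (k κ) ∧ (A κ).WeaklySymmetric) →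
      ∀ D : ∀ κ, PMF (U κ),
      (∀ κ, (A κ).BayesBuyerIC (D κ)) → (∀ κ, (A κ).BayesPlatformSellerIC (k κ) (D κ)) →
      ∃ r : ℕ → ℝ≥0, ∀ (κ : ℕ) (I : Finset (Id κ)),
        ∀ᵐ b ∂(Measure.pi fun _ : I => (D κ).toMeasure),
          (A κ).revenue I b ≤ postedRevenue (k κ) (r κ) b) := by
  refine ⟨fun U hU k P hP hB hS => EfficientProtocol.exists_reserve hU hP hB hS,
    fun Id _ U hU k A hA hB hS => ?_, fun U hU k P hP D _ hB hS =>
      EfficientProtocol.exists_reserve_bayes hU hP hB hS, fun Id _ U hU hfin k A hA D hB hS => ?_⟩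
  · choose r hr using fun κ =>
      Protocol.exists_reserve (hA κ).1 (hA κ).2 (hU κ) (hB κ) (hS κ)
    exact ⟨r, hr⟩
  · have := fun κ => (hfin κ).to_subtype
    choose r hr using fun κ =>
      Protocol.exists_reserve_bayes (hA κ).1 (hA κ).2 (hU κ) (D κ) (hB κ) (hS κ)
    exact ⟨r, hr⟩
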